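/- Let $F$ be a field of characteristic $0$, and let $SL(2)=SL(2,F)$ act by changes of variables on polynomials in $x,y$: the matrix $\begin{pmatrix} a&b\\ c&d\end{pmatrix}$ sends $x\mapsto ax+cy$, $y\mapsto bx+dy$. For $k\ge 0$ let $\rho_k$ be the resulting representation on the space $S^kV$ of homogeneous polynomials of degree $k$ in $x,y$. Let $m\ge 0$. A $0$-outerplanar graph is a multigraph (multiple edges allowed, no loops) with vertex set $\{1,\dots,m\}$, regarded as points of the real axis, whose edges can be drawn without intersections in the closed upper half-plane $\{z\in\mathbb{C}:\operatorname{Im} z\ge 0\}$: that is, as simple arcs joining their ends, which pass through no vertex in between and pairwise meet at most at their ends. For such a graph $G$ with vertex degrees $d_1,\dots,d_m$ let $\mathcal{O}(G)$ be the set of directed graphs obtained from $G$ by choosing a direction for every edge (parallel edges being distinguished, so that $|\mathcal{O}(G)|=2^{|E(G)|}$). For $g\in\mathcal{O}(G)$ let $d_i^{\mathrm{out}}(g)$ and $d_i^{\mathrm{in}}(g)$ be the numbers of arrows of $g$ beginning and ending at $i$, let $\operatorname{inv} g$ be the number of arrows $(k,l)$ of $g$ with $k>l$, and put $$b_g=\bigotimes_{i=1}^m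 x^{d_i^{\mathrm{out}}(g)}y^{d_i^{\mathrm{in}}(g)}\in S^{d_1}V\otimes\dots\otimes S^{d_m}V,\qquad t_G=\sum_{g\in\mathcal{O}(G)}(-1)^{\operatorname{inv} g}\,b_g .$$ Theorem. For any fixed integers $d_1,\dots,d_m\ge 0$, the tensors $t_G$, parametrized by all $0$-outerplanar graphs $G$ with vertex degrees $d_1,\dots,d_m$, form a basis of the subspace of $SL(2)$-invariants of the representation $\rho_{d_1}\otimes\dots\otimes\rho_{d_m}$. -/

import Mathlib

open scoped TensorProduct MatrixGroups

namespace SLTwoInvariants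

/-! ### Multigraphs -/

/-- A multigraph without loops on the vertices `1, …, m`, given by the multiplicities of its edges.
The vertex `k` of the text is the element `k - 1` of `Fin m`. -/
structure Multigraph (m : ℕ) where
  mult : Sym2 (Fin m) → ℕ
  loopless : ∀ e : Sym2 (Fin m), e.IsDiag → mult e = 0

namespace Multigraph

variable {m : ℕ}

/-- The edges of `G`: a pair of vertices of multiplicity `a` carries `a` distinct edges. -/
abbrev Edge (G : Multigraph m) : Type := Σ e : Sym2 (Fin m), Fin (G.mult e)

/-- The degree of the vertex `i`: the number of edges which have `i` as an end. -/
def degree (G : Multigraph m) (i : Fin m) : ℕ :=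
  (Finset.univ.filter fun e : G.Edge => i ∈ e.1).card

/-- The place of a vertex: the points `1, 2, …, m` of the real axis. -/
def vertexPoint (i : Fin m) : ℂ := ((i : ℕ) : ℂ) + 1

/-- `G` is `0`-outerplanar: its edges can be drawn in the closed upper half-plane as simple arcs
which join their ends, pass through no vertex in between, and pairwise meet at most in
their ends. -/
def IsZeroOuterplanar (G : Multigraph m) : Prop :=
  ∃ γ : G.Edge → C(unitInterval, ℂ),
    (∀ e, Function.Injective (γ e)) ∧
    (∀ e t, 0 ≤ (γ e t).im) ∧
    (∀ e, s(γ e 0, γ e 1) = e.1.map vertexPoint) ∧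
    (∀ e t, ∀ i : Fin m, γ e t = vertexPoint i → t = 0 ∨ t = 1) ∧
    (∀ e e', e ≠ e' → ∀ s t, γ e s = γ e' t → (s = 0 ∨ s = 1) ∧ (t = 0 ∨ t = 1))

/-- The set `𝒪(G)` of directed graphs with underlying graph `G`: each edge `{a, b}` becomes
one of the arrows `(a, b)`, `(b, a)`. -/
abbrev Orientation (G : Multigraph m) : Type :=
  (e : G.Edge) → {p : Fin m × Fin m // s(p.1, p.2) = e.1}

namespace Orientation

variable {G : Multigraph m}

/-- The number of arrows beginning in `i`. -/
def outDegree (g : G.Orientation) (i : Fin m) : ℕ :=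
  (Finset.univ.filter fun e : G.Edge => (g e).1.1 = i).card

/-- The number of arrows ending in `i`. -/
def inDegree (g : G.Orientation) (i : Fin m) : ℕ :=
  (Finset.univ.filter fun e : G.Edge => (g e).1.2 = i).card

/-- The number of inversions: the number of arrows `(k, l)` with `k > l`. -/
def inv (g : G.Orientation) : ℕ :=
  (Finset.univ.filter fun e : G.Edge => (g e).1.2 < (g e).1.1).card

theorem outDegree_add_inDegree (g : G.Orientation) (i : Fin m) :
    outDegree g i + inDegree g i = G.degree i := by
  unfold outDegree inDegree degree
  rw [← Finset.card_union_of_disjoint]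
  · congr 1
    ext e
    have h := (g e).2
    simp only [Finset.mem_union, Finset.mem_filter, Finset.mem_univ, true_and]
    have h2 : i ∈ e.1 ↔ i ∈ s((g e).1.1, (g e).1.2) := by rw [h]
    rw [h2, Sym2.mem_iff, @eq_comm _ i, @eq_comm _ i]
  · rw [Finset.disjoint_left]
    intro e he he'
    simp only [Finset.mem_filter, Finset.mem_univ, true_and] at he he'
    have h0 : G.mult e.1 = 0 := by
      apply G.loopless
      rw [← (g e).2, Sym2.mk_isDiag_iff, he, he']
    exact (Fin.cast h0 e.2).elim0

end Orientation

end Multigraph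

/-! ### The representations of `SL(2)` -/

section Representations

variable (F : Type*) [Field F]

/-- The space `S^k V` of homogeneous polynomials of degree `k` in `x = X 0`, `y = X 1`. -/
abbrev SymPow (k : ℕ) : Type _ := MvPolynomial.homogeneousSubmodule (Fin 2) F k

variable {F} in
/-- The change of variables `x ↦ a x + c y`, `y ↦ b x + d y` for the matrix with rows
`(a, b)`, `(c, d)`. -/
noncomputable def substHom (A : Matrix (Fin 2) (Fin 2) F) :
    MvPolynomial (Fin 2) F →ₐ[F] MvPolynomial (Fin 2) F :=
  MvPolynomial.aeval fun j => ∑ i, MvPolynomial.C (A i j) * MvPolynomial.X i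

variable {F} in
theorem substHom_mem (A : Matrix (Fin 2) (Fin 2) F) {k : ℕ} {p : MvPolynomial (Fin 2) F}
    (hp : p ∈ MvPolynomial.homogeneousSubmodule (Fin 2) F k) :
    substHom A p ∈ MvPolynomial.homogeneousSubmodule (Fin 2) F k := by
  rw [MvPolynomial.mem_homogeneousSubmodule] at hp ⊢
  have := hp.aeval (fun j => ∑ i, MvPolynomial.C (A i j) * MvPolynomial.X i) (n := 1)
    (fun j => MvPolynomial.IsHomogeneous.sum _ _ _ fun i _ =>
      (MvPolynomial.isHomogeneous_X F i).C_mul _)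
  simpa [substHom] using this

variable {F} in
theorem substHom_one : substHom (1 : Matrix (Fin 2) (Fin 2) F) = AlgHom.id F _ := by
  apply MvPolynomial.algHom_ext
  intro j
  fin_cases j <;> simp [substHom, Fin.sum_univ_two]

variable {F} in
theorem substHom_mul (A B : Matrix (Fin 2) (Fin 2) F) :
    substHom (A * B) = (substHom A).comp (substHom B) := by
  apply MvPolynomial.algHom_ext
  intro j
  simp only [substHom, MvPolynomial.aeval_X, AlgHom.comp_apply, Fin.sum_univ_two, map_add, map_mul,
    MvPolynomial.algHom_C, MvPolynomial.algebraMap_eq, Matrix.mul_apply]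
  ring

/-- The representation `ρ_k` of `SL(2)` in `S^k V` by changes of variables. -/
noncomputable def rho (k : ℕ) : Representation F SL(2, F) (SymPow F k) where
  toFun A := (substHom (A : Matrix (Fin 2) (Fin 2) F)).toLinearMap.restrict
    fun _ hp => substHom_mem _ hp
  map_one' := by
    ext p : 2
    simp [substHom_one]
  map_mul' A B := by
    ext p : 2
    change substHom _ _ = substHom _ (substHom _ _)
    simp [substHom_mul]

/-- The representation `ρ_{d_1} ⊗ ⋯ ⊗ ρ_{d_m}`. -/
noncomputable def tensorRho {m : ℕ} (d : Fin m → ℕ) :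
    Representation F SL(2, F) (⨂[F] i, SymPow F (d i)) :=
  PiTensorProduct.mapMonoidHom.comp (MonoidHom.pi fun i => rho F (d i))

/-- The subspace of invariants of `ρ_{d_1} ⊗ ⋯ ⊗ ρ_{d_m}`. -/
noncomputable def invariantTensors {m : ℕ} (d : Fin m → ℕ) :
    Submodule F (⨂[F] i, SymPow F (d i)) :=
  Representation.invariants (k := F) (V := ⨂[F] i, SymPow F (d i)) (tensorRho F d)

variable {m : ℕ} {d : Fin m → ℕ} {G : Multigraph m}

/-- `x_i(g)`, the monomial `x ^ out * y ^ in` at the vertex `i`. -/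
noncomputable def vertexMonomial (hG : ∀ i, G.degree i = d i) (g : G.Orientation) (i : Fin m) :
    SymPow F (d i) :=
  ⟨MvPolynomial.X 0 ^ Multigraph.Orientation.outDegree g i *
      MvPolynomial.X 1 ^ Multigraph.Orientation.inDegree g i, by
    rw [MvPolynomial.mem_homogeneousSubmodule, ← hG i,
      ← Multigraph.Orientation.outDegree_add_inDegree g i]
    exact (MvPolynomial.isHomogeneous_X_pow _ _).mul (MvPolynomial.isHomogeneous_X_pow _ _)⟩

/-- `b_g = x_1(g) ⊗ ⋯ ⊗ x_m(g)`. -/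
noncomputable def bTensor (hG : ∀ i, G.degree i = d i) (g : G.Orientation) :
    ⨂[F] i, SymPow F (d i) :=
  PiTensorProduct.tprod F fun i => vertexMonomial F hG g i

/-- `t_G`, the alternating sum of the `b_g` over all `g ∈ 𝒪(G)`. -/
noncomputable def tTensor (hG : ∀ i, G.degree i = d i) : ⨂[F] i, SymPow F (d i) :=
  ∑ g : G.Orientation, (-1 : F) ^ Multigraph.Orientation.inv g • bTensor F hG g

end Representations

/-- The `0`-outerplanar graphs with degrees `d_1, …, d_m`. -/
abbrev OuterplanarGraph {m : ℕ} (d : Fin m → ℕ) : Type :=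
  {G : Multigraph m // G.IsZeroOuterplanar ∧ ∀ i, G.degree i = d i}

end SLTwoInvariants

/-!
A tensor in `S^{d_1} V ⊗ ⋯ ⊗ S^{d_m} V` is the same thing as a polynomial in `x_1, y_1, …, x_m, y_m`
which is homogeneous of degree `d_i` in `(x_i, y_i)` (`toPoly`, `toPoly_injective`), and it is
invariant if and only if the polynomial is invariant under simultaneous changes of variables of
determinant `1`. Expanding a product of differences over the choices of directions shows that `t_G`
corresponds to the bracket monomial `∏ (x_i y_j - x_j y_i)`, one factor for each edge `{i, j}`,
`i < j` (`toPoly_tTensor`).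

A multigraph is `0`-outerplanar exactly when no two edges have alternating ends `i < k < j < l`.
Noncrossing edges are drawn by nested parabolic arcs. Conversely, if arcs `γ` and `δ` in the closed
upper half-plane have alternating ends and do not meet, then `γ s - δ t` has a continuous logarithm
on the unit square, while its argument changes by `-2π` along the boundary
(`exists_eq_of_alternating_ends`). Thus the graphs become noncrossing arc systems, recorded by
strictly upper triangular matrices of multiplicities (`IsArcSystem`).

Independence and spanning of the bracket monomials are proved together (`bracketBasis`), by
induction on the sum of the degrees plus the number of vertices of positive degree. Let `a < b` be
the first two vertices of positive degree, and let `R` be the specialization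
`(x_a, y_a) := (x_b, y_b)`.

* The kernel of `R` on multihomogeneous polynomials consists of the multiples of the bracket of `a`
  and `b` (`IsMultihomogeneous.bracket_dvd`), and the quotient of an invariant by the bracket is an
  invariant for the degrees lowered by one at `a` and `b`. On the side of graphs this is the removal
  of an edge `{a, b}` (`IsArcSystem.add_singleArc_iff`).
* The image of an invariant under `R` is an invariant for the degrees in which `a` is merged into
  `b`. On the side of graphs, a noncrossing graph without an edge `{a, b}` is determined by the graph in which
  `a` is merged into `b`, and every noncrossing graph of the merged degrees arises in this way: `b`
  keeps the edges with the nearest ends and `a` receives the others (`exists_greedy`,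
  `greedy_unique`).

So the bracket monomials of degrees `d` are compatible with the exact sequence given by `R`, and the
claim for `d` follows from the claim for the two smaller degree vectors. In the base case at most
one degree is positive, and there are no invariants of positive degree in one vector.
-/

/-! ### Crossing arcs in the upper half-plane -/

namespace SLTwoInvariants

/-- A continuous branch `h` of the logarithm along a path in the closed upper half-plane differs by
a constant from the explicit branch `log (-I z)`. -/
theorem log_sub_eq_of_im_exp_nonneg {h : ℝ → ℂ} (hc : Continuous h)
    (him : ∀ s, 0 ≤ (Complex.exp (h s)).im) (s t : ℝ) :
    h s - h t = Complex.log (-Complex.I * Complex.exp (h s)) -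
      Complex.log (-Complex.I * Complex.exp (h t)) := by
  have hne : ∀ s, -Complex.I * Complex.exp (h s) ≠ 0 := fun s =>
    mul_ne_zero (neg_ne_zero.2 Complex.I_ne_zero) (Complex.exp_ne_zero _)
  have hslit : ∀ s, -Complex.I * Complex.exp (h s) ∈ Complex.slitPlane := by
    intro s
    rcases (him s).lt_or_eq with h1 | h1
    · exact Or.inl (by simpa using h1)
    · refine Or.inr fun h2 => Complex.exp_ne_zero (h s) (Complex.ext ?_ h1.symm)
      simpa using h2
  have hlog : Continuous fun s => Complex.log (-Complex.I * Complex.exp (h s)) :=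
    Continuous.clog (by fun_prop) hslit
  have key := Complex.isCoveringMap_exp.eq_of_comp_eq (g₁ := h)
    (g₂ := fun s => Complex.log (-Complex.I * Complex.exp (h s)) +
      (h t - Complex.log (-Complex.I * Complex.exp (h t)))) hc
    (hlog.add continuous_const) (by
      funext s
      apply Subtype.ext
      simp only [Function.comp_apply, Complex.exp_add, Complex.exp_sub, Complex.exp_log (hne _)]
      have := Complex.exp_ne_zero (h t)
      field_simp) t (by simp)
  linear_combination congrFun key s

theorem arg_neg_I_mul_ofReal (x : ℝ) (hx : 0 < x) :
    (-Complex.I * (x : ℂ)).arg = -(Real.pi / 2) := by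
  rw [mul_comm, Complex.arg_real_mul _ hx, Complex.arg_neg_I]

theorem arg_neg_I_mul_ofReal_of_neg (x : ℝ) (hx : x < 0) :
    (-Complex.I * (x : ℂ)).arg = Real.pi / 2 := by
  have : -Complex.I * (x : ℂ) = ((-x : ℝ) : ℂ) * Complex.I := by push_cast; ring
  rw [this, Complex.arg_real_mul _ (by linarith), Complex.arg_I]

/-- Two arcs in the closed upper half-plane whose ends alternate on the real axis meet. -/
theorem exists_eq_of_alternating_ends {a b c d : ℝ} (hab : a < b) (hbc : b < c) (hcd : c < d)
    (γ δ : C(unitInterval, ℂ)) (hγ : ∀ t, 0 ≤ (γ t).im) (hδ : ∀ t, 0 ≤ (δ t).im)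
    (hγ0 : γ 0 = a) (hγ1 : γ 1 = c) (hδ0 : δ 0 = b) (hδ1 : δ 1 = d) :
    ∃ s t, γ s = δ t := by
  by_contra! hne
  let pr : ℝ → unitInterval := Set.projIcc 0 1 zero_le_one
  have hpr : Continuous pr := continuous_projIcc
  have pr0 : pr 0 = 0 := Set.projIcc_left _
  have pr1 : pr 1 = 1 := Set.projIcc_right _
  -- The difference `γ s - δ t` has a continuous logarithm `F` on the plane, but the argument
  -- changes by `-2π` along the boundary of the unit square.
  let f : C(ℝ × ℝ, ℂ) := ⟨fun p => γ (pr p.1) - δ (pr p.2), by fun_prop⟩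
  have hf : ∀ p, f p ≠ 0 := fun p => sub_ne_zero.2 (hne _ _)
  obtain ⟨F, ⟨-, hF⟩, -⟩ := Complex.isCoveringMapOn_exp.existsUnique_continuousMap_lifts f
    (a₀ := (0, 0)) (Complex.exp_log (hf _)) (fun p => hf p)
  have hF' : ∀ s t, Complex.exp (F (s, t)) = γ (pr s) - δ (pr t) := fun s t => congrFun hF (s, t)
  have e1 := log_sub_eq_of_im_exp_nonneg (h := fun s => F (s, 0)) (by fun_prop) (by
    intro s; simp [hF', pr0, hδ0, hγ]) 1 0
  have e2 := log_sub_eq_of_im_exp_nonneg (h := fun s => F (s, 1)) (by fun_prop) (by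
    intro s; simp [hF', pr1, hδ1, hγ]) 1 0
  have e3 := log_sub_eq_of_im_exp_nonneg (h := fun t => F (0, t) + Real.pi * Complex.I)
    (by fun_prop) (by
    intro s; simp [hF', pr0, hγ0, hδ, Complex.exp_add]) 1 0
  have e4 := log_sub_eq_of_im_exp_nonneg (h := fun t => F (1, t) + Real.pi * Complex.I)
    (by fun_prop) (by
    intro s; simp [hF', pr1, hγ1, hδ, Complex.exp_add]) 1 0
  simp only [Complex.exp_add, Complex.exp_pi_mul_I, hF', pr0, pr1, hγ0, hγ1, hδ0, hδ1]
    at e1 e2 e3 e4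
  have c1 : ∀ x y : ℝ, (x : ℂ) - y = ((x - y : ℝ) : ℂ) := by intros; push_cast; ring
  have c2 : ∀ x y : ℝ, ((x - y : ℝ) : ℂ) * -1 = ((y - x : ℝ) : ℂ) := by intros; push_cast; ring
  simp only [c1, c2] at e1 e2 e3 e4
  replace e1 := congrArg Complex.im e1
  replace e2 := congrArg Complex.im e2
  replace e3 := congrArg Complex.im e3
  replace e4 := congrArg Complex.im e4
  simp only [Complex.sub_im, Complex.add_im, Complex.log_im] at e1 e2 e3 e4
  rw [arg_neg_I_mul_ofReal (c - b) (by linarith),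
    arg_neg_I_mul_ofReal_of_neg (a - b) (by linarith)] at e1
  rw [arg_neg_I_mul_ofReal_of_neg (c - d) (by linarith),
    arg_neg_I_mul_ofReal_of_neg (a - d) (by linarith)] at e2
  rw [arg_neg_I_mul_ofReal (d - a) (by linarith),
    arg_neg_I_mul_ofReal (b - a) (by linarith)] at e3
  rw [arg_neg_I_mul_ofReal (d - c) (by linarith),
    arg_neg_I_mul_ofReal_of_neg (b - c) (by linarith)] at e4
  have := Real.pi_pos
  linarith

/-! ### Drawings of multigraphs -/

namespace Multigraph

variable {m : ℕ}

/-- No two edges of `G` have alternating ends. -/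
def IsNoncrossing (G : Multigraph m) : Prop :=
  ∀ i k j l : Fin m, i < k → k < j → j < l → 0 < G.mult s(i, j) → 0 < G.mult s(k, l) → False

theorem vertexPoint_eq (i : Fin m) : vertexPoint i = (((i : ℕ) + 1 : ℝ) : ℂ) := by
  simp [vertexPoint]

/-- An arc which joins two given points can be traversed from the first to the second. -/
theorem exists_arc_of_ends {γ : C(unitInterval, ℂ)} {i j : Fin m}
    (h : s(γ 0, γ 1) = s(i, j).map vertexPoint) (him : ∀ t, 0 ≤ (γ t).im) :
    ∃ γ' : C(unitInterval, ℂ), γ' 0 = vertexPoint i ∧ γ' 1 = vertexPoint j ∧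
      (∀ t, 0 ≤ (γ' t).im) ∧ ∀ t, ∃ t', (t' = 0 ∨ t' = 1 → t = 0 ∨ t = 1) ∧ γ' t = γ t' := by
  rw [Sym2.map_mk, Sym2.eq_iff] at h
  rcases h with h | h
  · exact ⟨γ, h.1, h.2, him, fun t => ⟨t, id, rfl⟩⟩
  · refine ⟨γ.comp ⟨unitInterval.symm, by fun_prop⟩, by simpa using h.2, by simpa using h.1,
      fun t => him _, fun t => ⟨unitInterval.symm t, ?_, rfl⟩⟩
    simp [or_comm]

theorem IsZeroOuterplanar.isNoncrossing {G : Multigraph m} (h : G.IsZeroOuterplanar) :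
    G.IsNoncrossing := by
  obtain ⟨γ, -, him, hends, -, hmeet⟩ := h
  intro i k j l hik hkj hjl hij hkl
  let e : G.Edge := ⟨s(i, j), ⟨0, hij⟩⟩
  let e' : G.Edge := ⟨s(k, l), ⟨0, hkl⟩⟩
  have hee : e ≠ e' := by
    intro h
    have h1 : s(i, j) = s(k, l) := congrArg Sigma.fst h
    rw [Sym2.eq_iff] at h1
    rcases h1 with h1 | h1
    · exact hik.ne h1.1
    · exact hkj.ne h1.2.symm
  obtain ⟨γ₁, h10, h11, him1, hγ₁⟩ := exists_arc_of_ends (hends e) (him e)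
  obtain ⟨γ₂, h20, h21, him2, hγ₂⟩ := exists_arc_of_ends (hends e') (him e')
  have hlt : ∀ {u v : Fin m}, u < v → (((u : ℕ) : ℝ) + 1) < ((v : ℕ) : ℝ) + 1 := fun h => by
    have : ((_ : ℕ) : ℝ) < _ := Nat.cast_lt.2 h
    linarith
  rw [vertexPoint_eq] at h10 h11 h20 h21
  obtain ⟨s, t, hst⟩ := exists_eq_of_alternating_ends (hlt hik) (hlt hkj) (hlt hjl) γ₁ γ₂ him1 him2
    h10 h11 h20 h21
  obtain ⟨s', hs', hs⟩ := hγ₁ s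
  obtain ⟨t', ht', ht⟩ := hγ₂ t
  obtain ⟨h0, h1⟩ := hmeet e e' hee s' t' (by rw [← hs, ← ht, hst])
  have inj : ∀ {u v : Fin m}, (((((u : ℕ) : ℝ) + 1 : ℝ)) : ℂ) = ((((v : ℕ) : ℝ) + 1 : ℝ) : ℂ) →
      u = v := by
    intro u v h
    rw [Complex.ofReal_inj] at h
    exact Fin.ext (Nat.cast_injective (R := ℝ) (by linarith))
  rcases hs' h0 with rfl | rfl <;> rcases ht' h1 with rfl | rfl
  · rw [h10, h20] at hst; exact hik.ne (inj hst)
  · rw [h10, h21] at hst; exact (hik.trans (hkj.trans hjl)).ne (inj hst)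
  · rw [h11, h20] at hst; exact hkj.ne (inj hst).symm
  · rw [h11, h21] at hst; exact hjl.ne (inj hst)

/-- The graph over the segment `[a, c]` of the parabola `y = h (x - a) (c - x)`. -/
noncomputable def parabolicArc (a c h : ℝ) : C(unitInterval, ℂ) :=
  ⟨fun t => ⟨a + t * (c - a), h * (t * (c - a)) * ((1 - t) * (c - a))⟩, by
    have : (fun t : unitInterval =>
        (⟨a + t * (c - a), h * (t * (c - a)) * ((1 - t) * (c - a))⟩ : ℂ)) =
        fun t : unitInterval => ((a + t * (c - a) : ℝ) : ℂ) +
          ((h * (t * (c - a)) * ((1 - t) * (c - a)) : ℝ) : ℂ) * Complex.I := by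
      funext t
      exact Complex.mk_eq_add_mul_I _ _
    rw [this]
    fun_prop⟩

theorem parabolicArc_re (a c h : ℝ) (t : unitInterval) :
    (parabolicArc a c h t).re = a + t * (c - a) := rfl

theorem parabolicArc_im (a c h : ℝ) (t : unitInterval) :
    (parabolicArc a c h t).im = h * (t * (c - a)) * ((1 - t) * (c - a)) := rfl

theorem parabolicArc_zero (a c h : ℝ) : parabolicArc a c h 0 = a := by
  apply Complex.ext <;> simp [parabolicArc_re, parabolicArc_im]

theorem parabolicArc_one (a c h : ℝ) : parabolicArc a c h 1 = c := by
  apply Complex.ext <;> simp [parabolicArc_re, parabolicArc_im]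

theorem parabolicArc_im_nonneg {a c h : ℝ} (hac : a < c) (hh : 0 < h) (t : unitInterval) :
    0 ≤ (parabolicArc a c h t).im := by
  rw [parabolicArc_im]
  have := t.2.1
  have := t.2.2
  have h1 : 0 ≤ 1 - (t : ℝ) := by linarith
  have h2 : 0 < c - a := by linarith
  positivity

theorem parabolicArc_injective {a c h : ℝ} (hac : a < c) :
    Function.Injective (parabolicArc a c h) := by
  intro s t hst
  have h1 := congrArg Complex.re hst
  rw [parabolicArc_re, parabolicArc_re] at h1
  have h2 : (c - a) ≠ 0 := (sub_pos.2 hac).ne'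
  exact Subtype.ext (mul_right_cancel₀ h2 (by linarith))

theorem eq_zero_or_one_of_parabolicArc_im {a c h : ℝ} (hac : a < c) (hh : 0 < h) {t : unitInterval}
    (ht : (parabolicArc a c h t).im = 0) : t = 0 ∨ t = 1 := by
  rw [parabolicArc_im] at ht
  have h2 : c - a ≠ 0 := (sub_pos.2 hac).ne'
  simp only [mul_eq_zero, hh.ne', h2, false_or, or_false] at ht
  rcases ht with ht | ht
  · exact Or.inl (Subtype.ext ht)
  · exact Or.inr (Subtype.ext (sub_eq_zero.1 ht).symm)

theorem parabolicArc_meet_of_le {a c h a' c' h' : ℝ} (hac : a < c) (hac' : a' < c') (hca : c ≤ a')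
    {s t : unitInterval} (hst : parabolicArc a c h s = parabolicArc a' c' h' t) :
    s = 1 ∧ t = 0 := by
  have h1 := congrArg Complex.re hst
  rw [parabolicArc_re, parabolicArc_re] at h1
  have hs : 0 ≤ (1 - (s : ℝ)) * (c - a) := mul_nonneg (by linarith [s.2.2]) (by linarith)
  have ht : 0 ≤ (t : ℝ) * (c' - a') := mul_nonneg t.2.1 (by linarith)
  have h2 : (1 - (s : ℝ)) * (c - a) = 0 := by nlinarith
  have h3 : (t : ℝ) * (c' - a') = 0 := by nlinarith
  rw [mul_eq_zero, or_iff_left (sub_pos.2 hac).ne'] at h2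
  rw [mul_eq_zero, or_iff_left (sub_pos.2 hac').ne'] at h3
  exact ⟨Subtype.ext (sub_eq_zero.1 h2).symm, Subtype.ext h3⟩

theorem parabolicArc_meet_of_nested {a c h a' c' h' : ℝ} (hac : a < c) (hac' : a' < c')
    (ha : a ≤ a') (hc : c' ≤ c) (hh : h' < h) (hh' : 0 < h')
    {s t : unitInterval} (hst : parabolicArc a c h s = parabolicArc a' c' h' t) :
    (s = 0 ∨ s = 1) ∧ (t = 0 ∨ t = 1) := by
  have h1 := congrArg Complex.re hst
  have h2 := congrArg Complex.im hst
  by_cases ht : t = 0 ∨ t = 1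
  · refine ⟨eq_zero_or_one_of_parabolicArc_im hac (hh'.trans hh) ?_, ht⟩
    rw [h2]
    rcases ht with rfl | rfl
    · rw [parabolicArc_zero, Complex.ofReal_im]
    · rw [parabolicArc_one, Complex.ofReal_im]
  · exfalso
    push Not at ht
    have t0 : 0 < (t : ℝ) := lt_of_le_of_ne t.2.1 fun h => ht.1 (Subtype.ext h.symm)
    have t1 : 0 < 1 - (t : ℝ) := sub_pos.2 (lt_of_le_of_ne t.2.2 fun h => ht.2 (Subtype.ext h))
    rw [parabolicArc_re, parabolicArc_re] at h1
    rw [parabolicArc_im, parabolicArc_im] at h2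
    have p1 : 0 < (t : ℝ) * (c' - a') := mul_pos t0 (by linarith)
    have p2 : 0 < (1 - (t : ℝ)) * (c' - a') := mul_pos t1 (by linarith)
    have q1 : (t : ℝ) * (c' - a') ≤ (s : ℝ) * (c - a) := by linarith
    have q2 : (1 - (t : ℝ)) * (c' - a') ≤ (1 - (s : ℝ)) * (c - a) := by linarith
    have : h' * ((t : ℝ) * (c' - a')) * ((1 - (t : ℝ)) * (c' - a')) <
        h * ((s : ℝ) * (c - a)) * ((1 - (s : ℝ)) * (c - a)) := by
      calc _ < h * ((t : ℝ) * (c' - a')) * ((1 - (t : ℝ)) * (c' - a')) := by gcongr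
        _ ≤ _ := by
          have h3 := hh'.trans hh
          have h4 : 0 ≤ h * ((s : ℝ) * (c - a)) := mul_nonneg h3.le (p1.le.trans q1)
          gcongr
    linarith

theorem exists_ends (G : Multigraph m) (e : G.Edge) :
    ∃ i j : Fin m, i < j ∧ e.1 = s(i, j) := by
  obtain ⟨e, k⟩ := e
  induction e using Sym2.ind with
  | _ i j =>
    rcases lt_trichotomy i j with h | h | h
    · exact ⟨i, j, h, rfl⟩
    · have := G.loopless s(i, j) (by simpa using h)
      exact absurd k.2 (by omega)
    · exact ⟨j, i, h, Sym2.eq_swap⟩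

/-- A noncrossing multigraph is drawn by parabolic arcs. The height parameter of an arc grows with
its span, and among parallel edges with the index of the edge. -/
theorem IsNoncrossing.isZeroOuterplanar {G : Multigraph m} (h : G.IsNoncrossing) :
    G.IsZeroOuterplanar := by
  choose lo hi hlt hends using G.exists_ends
  let a : G.Edge → ℝ := fun e => (lo e : ℕ) + 1
  let c : G.Edge → ℝ := fun e => (hi e : ℕ) + 1
  let b : G.Edge → ℝ := fun e => (e.2 : ℕ) / ((e.2 : ℕ) + 1)
  let H : G.Edge → ℝ := fun e => (c e - a e) + b e
  have hac : ∀ e, a e < c e := fun e => by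
    have : ((lo e : ℕ) : ℝ) < (hi e : ℕ) := Nat.cast_lt.2 (hlt e)
    simp only [a, c]; linarith
  have hb0 : ∀ e, 0 ≤ b e := fun e => by positivity
  have hb1 : ∀ e, b e < 1 := fun e => by
    simp only [b]
    rw [div_lt_one (by positivity)]
    linarith
  have hH : ∀ e, 0 < H e := fun e => by
    have := hac e; have := hb0 e
    simp only [H]; linarith
  have hvp : ∀ e, (a e : ℂ) = vertexPoint (lo e) ∧ (c e : ℂ) = vertexPoint (hi e) := fun e =>
    ⟨(vertexPoint_eq _).symm, (vertexPoint_eq _).symm⟩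
  -- Distinct edges with nested ends have arcs which meet only at common ends.
  have nested : ∀ e e', e ≠ e' → lo e ≤ lo e' → hi e' ≤ hi e → ∀ s t,
      parabolicArc (a e) (c e) (H e) s = parabolicArc (a e') (c e') (H e') t →
      (s = 0 ∨ s = 1) ∧ (t = 0 ∨ t = 1) := by
    intro e e' hne hl hh s t hst
    have ha : a e ≤ a e' := by
      have : ((lo e : ℕ) : ℝ) ≤ (lo e' : ℕ) := Nat.cast_le.2 hl
      simp only [a]; linarith
    have hc : c e' ≤ c e := by
      have : ((hi e' : ℕ) : ℝ) ≤ (hi e : ℕ) := Nat.cast_le.2 hh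
      simp only [c]; linarith
    by_cases heq : lo e = lo e' ∧ hi e = hi e'
    · have ha' : a e = a e' := by simp only [a, heq.1]
      have hc' : c e = c e' := by simp only [c, heq.2]
      have hb : b e ≠ b e' := by
        intro hbb
        apply hne
        have h1 : e.1 = e'.1 := by rw [hends e, hends e', heq.1, heq.2]
        have h2 : (e.2 : ℕ) = e'.2 := by
          simp only [b] at hbb
          rw [div_eq_div_iff (by positivity) (by positivity)] at hbb
          exact Nat.cast_injective (R := ℝ) (by linarith)
        obtain ⟨e1, k⟩ := e
        obtain ⟨e2, k'⟩ := e'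
        obtain rfl : e1 = e2 := h1
        exact congrArg _ (Fin.ext h2)
      rcases lt_or_gt_of_ne hb with hb | hb
      · exact (parabolicArc_meet_of_nested (hac e') (hac e) ha'.symm.le hc'.le
          (by simp only [H]; linarith) (hH e) hst.symm).symm
      · exact parabolicArc_meet_of_nested (hac e) (hac e') ha hc
          (by simp only [H]; linarith) (hH e') hst
    · refine parabolicArc_meet_of_nested (hac e) (hac e') ha hc ?_ (hH e') hst
      have hn : (hi e' : ℕ) + lo e + 1 ≤ hi e + lo e' := by
        have h1 : (lo e : ℕ) ≤ lo e' := hl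
        have h2 : (hi e' : ℕ) ≤ hi e := hh
        by_contra hcon
        exact heq ⟨Fin.ext (by omega), Fin.ext (by omega)⟩
      have hn' : ((hi e' : ℕ) : ℝ) + (lo e : ℕ) + 1 ≤ (hi e : ℕ) + (lo e' : ℕ) := by
        exact_mod_cast hn
      have := hb1 e'
      have := hb0 e
      simp only [H, a, c]
      linarith
  have apart : ∀ e e', hi e ≤ lo e' → ∀ s t,
      parabolicArc (a e) (c e) (H e) s = parabolicArc (a e') (c e') (H e') t →
      s = 1 ∧ t = 0 := by
    intro e e' hl s t hst
    have : ((hi e : ℕ) : ℝ) ≤ (lo e' : ℕ) := Nat.cast_le.2 hl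
    exact parabolicArc_meet_of_le (hac e) (hac e') (by simp only [a, c]; linarith) hst
  have hpos : ∀ e, 0 < G.mult s(lo e, hi e) := fun e => by
    rw [← hends e]
    exact e.2.pos
  refine ⟨fun e => parabolicArc (a e) (c e) (H e), fun e => parabolicArc_injective (hac e),
    fun e t => parabolicArc_im_nonneg (hac e) (hH e) t, fun e => ?_, fun e t i hi => ?_,
    fun e e' hne s t hst => ?_⟩
  · rw [parabolicArc_zero, parabolicArc_one, hends e, Sym2.map_mk, (hvp e).1, (hvp e).2]
  · refine eq_zero_or_one_of_parabolicArc_im (hac e) (hH e) ?_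
    rw [hi, vertexPoint_eq, Complex.ofReal_im]
  · rcases le_or_gt (hi e) (lo e') with h1 | h1
    · exact (apart e e' h1 s t hst).imp Or.inr Or.inl
    rcases le_or_gt (hi e') (lo e) with h2 | h2
    · exact (apart e' e h2 t s hst.symm).symm.imp Or.inl Or.inr
    rcases le_or_gt (lo e) (lo e') with h3 | h3 <;> rcases le_or_gt (hi e') (hi e) with h4 | h4
    · exact nested e e' hne h3 h4 s t hst
    · rcases h3.lt_or_eq with h5 | h5
      · exact (h _ _ _ _ h5 h1 h4 (hpos e) (hpos e')).elim
      · exact (nested e' e hne.symm h5.ge h4.le t s hst.symm).symm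
    · rcases h4.lt_or_eq with h5 | h5
      · exact (h _ _ _ _ h3 h2 h5 (hpos e') (hpos e)).elim
      · exact (nested e' e hne.symm h3.le h5.ge t s hst.symm).symm
    · exact (nested e' e hne.symm h3.le h4.le t s hst.symm).symm

end Multigraph

end SLTwoInvariants

/-! ### Multihomogeneous invariant polynomials -/

namespace SLTwoInvariants

open MvPolynomial

section Polynomials

variable {F : Type*} [Field F] {V : Type*}

/-- `f` is homogeneous of degree `d i` in the pair of variables `x_i = X (i, 0)`,
`y_i = X (i, 1)`, for every vertex `i`. -/
def IsMultihomogeneous [Fintype V] (d : V → ℕ) (f : MvPolynomial (V × Fin 2) F) : Prop :=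
  ∀ (c : V → F) (x : V × Fin 2 → F),
    eval (fun p => c p.1 * x p) f = (∏ i, c i ^ d i) * eval x f

/-- The simultaneous change of variables at all the vertices: the point `(x_i, y_i)`, as a row, is
multiplied by `A`. -/
def rowMul (A : SL(2, F)) (x : V × Fin 2 → F) (p : V × Fin 2) : F :=
  ∑ k, A k p.2 * x (p.1, k)

/-- `f` is invariant under simultaneous changes of variables of determinant `1`. -/
def IsSLInvariant (f : MvPolynomial (V × Fin 2) F) : Prop :=
  ∀ (A : SL(2, F)) (x : V × Fin 2 → F), eval (rowMul A x) f = eval x f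

theorem eval_aeval {σ τ : Type*} (x : τ → F) (u : σ → MvPolynomial τ F) (f : MvPolynomial σ F) :
    eval x (aeval u f) = eval (fun p => eval x (u p)) f :=
  comp_aeval_apply (f := u) (aeval x : MvPolynomial τ F →ₐ[F] F) f

variable (F) in
/-- The determinant `x_i y_j - x_j y_i`. -/
noncomputable def bracket (i j : V) : MvPolynomial (V × Fin 2) F :=
  X (i, 0) * X (j, 1) - X (j, 0) * X (i, 1)

theorem eval_bracket (i j : V) (x : V × Fin 2 → F) :
    eval x (bracket F i j) = x (i, 0) * x (j, 1) - x (j, 0) * x (i, 1) := by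
  simp [bracket]

theorem bracket_ne_zero {i j : V} (h : i ≠ j) : bracket F i j ≠ 0 := by
  classical
  intro h0
  have := congrArg (eval fun p : V × Fin 2 => if p = (i, 0) ∨ p = (j, 1) then (1 : F) else 0) h0
  simp [eval_bracket, h.symm] at this

theorem isSLInvariant_bracket (i j : V) : IsSLInvariant (bracket F i j) := by
  intro A x
  have hA := A.det_coe
  rw [Matrix.det_fin_two] at hA
  simp only [eval_bracket, rowMul, Fin.sum_univ_two]
  linear_combination (x (i, 0) * x (j, 1) - x (j, 0) * x (i, 1)) * hA

namespace IsSLInvariant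

theorem pow {f : MvPolynomial (V × Fin 2) F} (hf : IsSLInvariant f) (n : ℕ) :
    IsSLInvariant (f ^ n) := fun A x => by simp [hf A x]

theorem prod {ι : Type*} {s : Finset ι} {f : ι → MvPolynomial (V × Fin 2) F}
    (hf : ∀ i ∈ s, IsSLInvariant (f i)) : IsSLInvariant (∏ i ∈ s, f i) := fun A x => by
  simp only [map_prod]
  exact Finset.prod_congr rfl fun i hi => hf i hi A x

theorem sub {f g : MvPolynomial (V × Fin 2) F} (hf : IsSLInvariant f) (hg : IsSLInvariant g) :
    IsSLInvariant (f - g) := fun A x => by simp [hf A x, hg A x]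

variable (V F) in
/-- The subspace of invariant polynomials. -/
def submodule : Submodule F (MvPolynomial (V × Fin 2) F) where
  carrier := {f | IsSLInvariant f}
  add_mem' hf hg A x := by simp [hf A x, hg A x]
  zero_mem' A x := by simp
  smul_mem' c f hf A x := by simp [hf A x]

end IsSLInvariant

/-- The substitution `(x_a, y_a) := (x_b, y_b)`. -/
noncomputable def identify (F : Type*) [Field F] [DecidableEq V] (a b : V) :
    MvPolynomial (V × Fin 2) F →ₐ[F] MvPolynomial (V × Fin 2) F :=
  rename (Prod.map (Function.update id a b) id)

theorem eval_identify [DecidableEq V] (a b : V) (x : V × Fin 2 → F)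
    (f : MvPolynomial (V × Fin 2) F) :
    eval x (identify F a b f) = eval (fun p => x (Function.update id a b p.1, p.2)) f := by
  rw [identify, eval_rename]
  rfl

theorem identify_bracket [DecidableEq V] (a b i j : V) : identify F a b (bracket F i j) =
    bracket F (Function.update id a b i) (Function.update id a b j) := by
  simp [identify, bracket, rename_X]

theorem IsSLInvariant.identify [DecidableEq V] {f : MvPolynomial (V × Fin 2) F}
    (hf : IsSLInvariant f) (a b : V) : IsSLInvariant (SLTwoInvariants.identify F a b f) := by
  intro A x
  rw [eval_identify, eval_identify]
  exact hf A fun p => x (Function.update id a b p.1, p.2)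

theorem IsSLInvariant.of_bracket_mul [Infinite F] {a b : V} (hab : a ≠ b)
    {f : MvPolynomial (V × Fin 2) F} (hf : IsSLInvariant (bracket F a b * f)) :
    IsSLInvariant f := by
  intro A
  have : aeval (fun p : V × Fin 2 => ∑ k, C (A k p.2) * X (p.1, k)) f = f := by
    refine mul_left_cancel₀ (bracket_ne_zero (F := F) hab) (MvPolynomial.funext fun x => ?_)
    have h := hf A x
    rw [map_mul, map_mul, isSLInvariant_bracket a b A x] at h
    simp only [map_mul, eval_aeval, map_sum, eval_C, eval_X]
    exact h
  intro x
  have := congrArg (eval x) this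
  simp only [map_mul, eval_aeval, map_sum, eval_C, eval_X] at this
  exact this

variable [Fintype V]

theorem isMultihomogeneous_bracket [DecidableEq V] {a b : V} :
    IsMultihomogeneous (Pi.single a 1 + Pi.single b 1) (bracket F a b) := by
  intro c x
  have h : ∀ i : V, ∏ j, c j ^ (Pi.single i 1 : V → ℕ) j = c i := fun i => by
    rw [Finset.prod_eq_single i] <;> simp +contextual
  simp only [Pi.add_apply, pow_add, Finset.prod_mul_distrib, h, eval_bracket]
  ring

namespace IsMultihomogeneous

variable {d : V → ℕ}

theorem sub {f g : MvPolynomial (V × Fin 2) F} (hf : IsMultihomogeneous d f)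
    (hg : IsMultihomogeneous d g) : IsMultihomogeneous d (f - g) := fun c x => by
  simp [hf c x, hg c x, mul_sub]

variable (F d) in
/-- The subspace of multihomogeneous polynomials. -/
def submodule : Submodule F (MvPolynomial (V × Fin 2) F) where
  carrier := {f | IsMultihomogeneous d f}
  add_mem' hf hg c x := by simp [hf c x, hg c x, mul_add]
  zero_mem' c x := by simp
  smul_mem' r f hf c x := by simp [hf c x, mul_left_comm]

theorem pow {f : MvPolynomial (V × Fin 2) F} (hf : IsMultihomogeneous d f) (n : ℕ) :
    IsMultihomogeneous (n • d) (f ^ n) := fun c x => by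
  simp only [map_pow, hf c x, Pi.smul_apply, smul_eq_mul, mul_pow, ← Finset.prod_pow]
  congr 1
  exact Finset.prod_congr rfl fun i _ => by rw [← pow_mul, mul_comm]

theorem prod {ι : Type*} {s : Finset ι} {D : ι → V → ℕ} {f : ι → MvPolynomial (V × Fin 2) F}
    (hf : ∀ i ∈ s, IsMultihomogeneous (D i) (f i)) :
    IsMultihomogeneous (∑ i ∈ s, D i) (∏ i ∈ s, f i) := fun c x => by
  simp only [map_prod, Finset.sum_apply, ← Finset.prod_pow_eq_pow_sum]
  rw [Finset.prod_comm, ← Finset.prod_mul_distrib]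
  exact Finset.prod_congr rfl fun i hi => hf i hi c x

/-- Scaling by polynomial factors. -/
theorem aeval_mul [Infinite F] {f : MvPolynomial (V × Fin 2) F} (hf : IsMultihomogeneous d f)
    (c : V → MvPolynomial (V × Fin 2) F) (q : V × Fin 2 → MvPolynomial (V × Fin 2) F) :
    aeval (fun p => c p.1 * q p) f = (∏ i, c i ^ d i) * aeval q f := by
  refine MvPolynomial.funext fun x => ?_
  rw [eval_aeval, map_mul, eval_aeval, map_prod]
  simpa using hf (fun i => eval x (c i)) fun p => eval x (q p)

/-- Homogeneity need only be checked for nonzero scalars. -/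
theorem of_ne_zero [Infinite F] {f : MvPolynomial (V × Fin 2) F}
    (hf : ∀ (c : V → F) (x : V × Fin 2 → F), (∀ i, c i ≠ 0) →
      eval (fun p => c p.1 * x p) f = (∏ i, c i ^ d i) * eval x f) : IsMultihomogeneous d f := by
  intro c x
  let P : MvPolynomial V F :=
    aeval (fun p : V × Fin 2 => X p.1 * C (x p)) f - (∏ i, X i ^ d i) * C (eval x f)
  have hP : ∀ c : V → F,
      eval c P = eval (fun p => c p.1 * x p) f - (∏ i, c i ^ d i) * eval x f := by
    intro c
    simp only [P, map_sub, eval_aeval, map_mul, map_prod, map_pow, eval_X, eval_C]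
  have h0 : P * ∏ i, X i = 0 := by
    refine MvPolynomial.funext fun c => ?_
    rw [map_mul, map_prod, map_zero]
    by_cases hc : ∀ i, c i ≠ 0
    · rw [hP, hf c x hc, sub_self, zero_mul]
    · push Not at hc
      obtain ⟨i, hi⟩ := hc
      rw [Finset.prod_eq_zero (Finset.mem_univ i) (by simpa using hi), mul_zero]
  rw [mul_eq_zero, or_iff_left (Finset.prod_ne_zero_iff.2 fun i _ => X_ne_zero i)] at h0
  have := hP c
  rw [h0, map_zero] at this
  exact (sub_eq_zero.1 this.symm)

/-- A bracket factor lowers the degrees of its two vertices by one. -/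
theorem of_bracket_mul [Infinite F] [DecidableEq V] {a b : V} (hab : a ≠ b)
    {f : MvPolynomial (V × Fin 2) F}
    (hf : IsMultihomogeneous (d + (Pi.single a 1 + Pi.single b 1)) (bracket F a b * f)) :
    IsMultihomogeneous d f := by
  refine of_ne_zero fun c x hc => ?_
  revert x
  have : aeval (fun p => C (c p.1) * X p) f = C (∏ i, c i ^ d i) * f := by
    refine mul_left_cancel₀ (bracket_ne_zero (F := F) hab) (MvPolynomial.funext fun x => ?_)
    have h := hf c x
    have h' := isMultihomogeneous_bracket (F := F) (a := a) (b := b) c x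
    have hc' : ∏ i, c i ^ (Pi.single a 1 + Pi.single b 1 : V → ℕ) i ≠ 0 :=
      Finset.prod_ne_zero_iff.2 fun i _ => pow_ne_zero _ (hc i)
    rw [map_mul, map_mul, h'] at h
    simp only [Pi.add_apply d, pow_add, Finset.prod_mul_distrib] at h
    refine mul_left_cancel₀ hc' ?_
    simp only [map_mul, eval_aeval, eval_C, eval_X]
    linear_combination h
  intro x
  have := congrArg (eval x) this
  simpa only [map_mul, eval_aeval, eval_C, eval_X] using this

end IsMultihomogeneous

theorem IsMultihomogeneous.identify [DecidableEq V] {d : V → ℕ} {f : MvPolynomial (V × Fin 2) F}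
    (hf : IsMultihomogeneous d f) {a b : V} (hab : a ≠ b) :
    IsMultihomogeneous (Function.update (Function.update d a 0) b (d a + d b))
      (SLTwoInvariants.identify F a b f) := by
  intro c x
  rw [eval_identify, eval_identify]
  refine (hf (fun i => c (Function.update id a b i)) _).trans ?_
  congr 1
  rw [← Finset.mul_prod_erase _ _ (Finset.mem_univ a),
    ← Finset.mul_prod_erase _ _ (Finset.mem_erase.2 ⟨hab.symm, Finset.mem_univ b⟩),
    ← Finset.mul_prod_erase _ _ (Finset.mem_univ a),
    ← Finset.mul_prod_erase _ _ (Finset.mem_erase.2 ⟨hab.symm, Finset.mem_univ b⟩), ← mul_assoc,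
    ← mul_assoc]
  congr 1
  · simp [hab, hab.symm, pow_add]
  · refine Finset.prod_congr rfl fun i hi => ?_
    simp only [Finset.mem_erase] at hi
    simp [Function.update_of_ne, hi.1, hi.2.1]

/-- A multihomogeneous polynomial which vanishes for `(x_a, y_a) = (x_b, y_b)` is divisible by
`x_a y_b - x_b y_a`: modulo the bracket, `y_b ^ d_a f` is congruent to `y_a ^ d_a` times the
specialization of `f`, and `y_b` is a prime which does not divide the bracket. -/
theorem IsMultihomogeneous.bracket_dvd [Infinite F] [DecidableEq V] {d : V → ℕ}
    {f : MvPolynomial (V × Fin 2) F} (hf : IsMultihomogeneous d f) {a b : V} (hab : a ≠ b)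
    (h0 : SLTwoInvariants.identify F a b f = 0) : bracket F a b ∣ f := by
  let u : V × Fin 2 → MvPolynomial (V × Fin 2) F := fun p =>
    (Function.update (fun _ => 1) a (X (b, 1)) : V → MvPolynomial (V × Fin 2) F) p.1 * X p
  let v : V × Fin 2 → MvPolynomial (V × Fin 2) F := fun p =>
    (Function.update (fun _ => 1) a (X (a, 1)) : V → MvPolynomial (V × Fin 2) F) p.1 *
      X (Prod.map (Function.update id a b) id p)
  have hprod : ∀ z : MvPolynomial (V × Fin 2) F,
      ∏ i, (Function.update (fun _ => 1) a z : V → MvPolynomial (V × Fin 2) F) i ^ d i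
        = z ^ d a := fun z => by
    rw [Finset.prod_eq_single a] <;> simp +contextual [Function.update_of_ne]
  have hu : aeval u f = X (b, 1) ^ d a * f := by
    rw [hf.aeval_mul, hprod, aeval_X_left_apply]
  have hv : aeval v f = 0 := by
    rw [hf.aeval_mul (Function.update (fun _ => 1) a (X (a, 1)))
      fun p => X (Prod.map (Function.update id a b) id p)]
    have : aeval (fun p => X (Prod.map (Function.update id a b) id p)) f =
      SLTwoInvariants.identify F a b f := by
      rw [SLTwoInvariants.identify, rename_eq_aeval]
      rfl
    rw [this, h0, mul_zero]
  have hcong : bracket F a b ∣ aeval u f - aeval v f := by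
    rw [← Ideal.mem_span_singleton, ← Ideal.Quotient.eq]
    have : ((Ideal.Quotient.mkₐ F (Ideal.span {bracket F a b})).comp (aeval u)) =
        (Ideal.Quotient.mkₐ F (Ideal.span {bracket F a b})).comp (aeval v) := by
      refine MvPolynomial.algHom_ext fun p => ?_
      simp only [AlgHom.comp_apply, aeval_X, Ideal.Quotient.mkₐ_eq_mk]
      rw [Ideal.Quotient.eq, Ideal.mem_span_singleton]
      obtain ⟨i, k⟩ := p
      by_cases hi : i = a
      · subst hi
        fin_cases k
        · refine ⟨1, ?_⟩
          simp [u, v, bracket]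
          ring
        · simp [u, v, mul_comm]
      · simp [u, v, Function.update_of_ne hi]
    exact DFunLike.congr_fun this f
  rw [hu, hv, sub_zero] at hcong
  obtain ⟨g, hg⟩ := hcong
  have hp : Prime (X (b, 1) : MvPolynomial (V × Fin 2) F) := X_prime
  have hnd : ¬ X (b, 1) ∣ bracket F a b := by
    rintro ⟨q, hq⟩
    have := congrArg (eval fun p : V × Fin 2 => if p = (b, 1) then (0 : F) else 1) hq
    simp [eval_bracket, hab] at this
  obtain ⟨q, rfl⟩ := hp.pow_dvd_of_dvd_mul_left (d a) hnd ⟨f, hg.symm⟩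
  refine ⟨q, mul_left_cancel₀ (pow_ne_zero (d a) hp.ne_zero) ?_⟩
  rw [hg]
  ring

/-- A multihomogeneous invariant all of whose degrees vanish is constant. -/
theorem IsMultihomogeneous.eq_C [Infinite F] {d : V → ℕ} {f : MvPolynomial (V × Fin 2) F}
    (hf : IsMultihomogeneous d f) (hd : ∀ i, d i = 0) : f = C (eval 0 f) := by
  refine MvPolynomial.funext fun x => ?_
  have := hf 0 x
  simp only [hd, pow_zero, Finset.prod_const_one, one_mul] at this
  rw [← this, eval_C]
  congr 2
  funext p
  simp

/-- There are no nonzero invariants of positive degree in one vector: any vector `p` is an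
eigenvector of eigenvalue `2` of a matrix of determinant `1`. -/
theorem IsMultihomogeneous.eq_zero_of_isSLInvariant [CharZero F] {d : V → ℕ}
    {f : MvPolynomial (V × Fin 2) F} (hf : IsMultihomogeneous d f) (hinv : IsSLInvariant f)
    {a : V} (ha : d a ≠ 0) (hd : ∀ i, i ≠ a → d i = 0) : f = 0 := by
  classical
  have hprod : ∀ c : V → F, ∏ i, c i ^ d i = c a ^ d a := fun c =>
    Finset.prod_eq_single a (fun i _ hi => by rw [hd i hi, pow_zero]) (by simp)
  refine MvPolynomial.funext fun x => ?_
  let y : V × Fin 2 → F := fun p => (Pi.single a 1 : V → F) p.1 * x p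
  have hy : eval y f = eval x f := by
    rw [hf, hprod, Pi.single_eq_same, one_pow, one_mul]
  obtain ⟨A, hA⟩ : ∃ A : SL(2, F), rowMul A y = fun p => 2 * y p := by
    have h2 : (2 : F) ≠ 0 := two_ne_zero
    by_cases hx : x (a, 0) = 0
    · refine ⟨⟨!![2⁻¹, 0; 0, 2], by simp [Matrix.det_fin_two]⟩, ?_⟩
      funext ⟨i, k⟩
      by_cases hi : i = a
      · subst hi
        fin_cases k <;> simp [rowMul, y, hx]
      · simp [rowMul, y, hi]
    · refine ⟨⟨!![2, (2 - 2⁻¹) * x (a, 1) / x (a, 0); 0, 2⁻¹], by simp [Matrix.det_fin_two]⟩, ?_⟩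
      funext ⟨i, k⟩
      by_cases hi : i = a
      · subst hi
        fin_cases k
        · simp [rowMul, y]
        · simp [rowMul, y]
          field_simp
          ring
      · simp [rowMul, y, hi]
  have h1 := hinv A y
  rw [hA, hf (fun _ => 2) y, hprod] at h1
  have h3 : (2 : F) ^ d a ≠ 1 := by
    exact_mod_cast (Nat.one_lt_two_pow ha).ne'
  rw [← hy, map_zero]
  have : ((2 : F) ^ d a - 1) * eval y f = 0 := by linear_combination h1
  exact (mul_eq_zero.1 this).resolve_left (sub_ne_zero.2 h3)

end Polynomials

end SLTwoInvariants

/-! ### Noncrossing arc systems -/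

namespace SLTwoInvariants

section Combinatorics

variable {V : Type*}

section Matrices

variable [DecidableEq V]

/-- The matrix of a single arc. -/
def singleArc (a b : V) : V → V → ℕ := Pi.single a (Pi.single b 1)

theorem singleArc_apply (a b i j : V) : singleArc a b i j = if i = a ∧ j = b then 1 else 0 := by
  unfold singleArc
  by_cases hi : i = a
  · subst hi
    simp [Pi.single_apply]
  · simp [hi]

/-- Row `a` is added to row `b` and then cleared. -/
def mergeRows (a b : V) (M : V → V → ℕ) : V → V → ℕ := fun i =>
  if i = a then 0 else if i = b then M a + M b else M i

theorem mergeRows_left (a b : V) (M : V → V → ℕ) : mergeRows a b M a = 0 := by simp [mergeRows]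

theorem mergeRows_right {a b : V} (hab : a ≠ b) (M : V → V → ℕ) :
    mergeRows a b M b = M a + M b := by simp [mergeRows, hab.symm]

theorem mergeRows_of_ne {a b i : V} (ha : i ≠ a) (hb : i ≠ b) (M : V → V → ℕ) :
    mergeRows a b M i = M i := by simp [mergeRows, ha, hb]

/-- Merging rows moves an arc which begins in `a` to `b`. -/
theorem mergeRows_pos {M : V → V → ℕ} {a b : V} (hab : a ≠ b) {i j : V} (hij : 0 < M i j) :
    0 < mergeRows a b M (Function.update id a b i) j := by
  by_cases hia : i = a
  · subst hia
    rw [Function.update_self, mergeRows_right hab, Pi.add_apply]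
    omega
  · rw [Function.update_of_ne hia, id]
    by_cases hib : i = b
    · subst hib
      rw [mergeRows_right hab, Pi.add_apply]
      omega
    · rwa [mergeRows_of_ne hia hib]

end Matrices

variable [Fintype V]

@[to_additive]
theorem prod_congr_of_mul_eq {N : Type*} [CommMonoid N] {a b : V} (hab : a ≠ b) {f g : V → N}
    (h : f a * f b = g a * g b) (h' : ∀ i, i ≠ a → i ≠ b → f i = g i) :
    ∏ i, f i = ∏ i, g i := by
  classical
  have hb : b ∈ Finset.univ.erase a := Finset.mem_erase.2 ⟨hab.symm, Finset.mem_univ b⟩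
  rw [← Finset.mul_prod_erase _ _ (Finset.mem_univ a), ← Finset.mul_prod_erase _ _ hb,
    ← Finset.mul_prod_erase _ _ (Finset.mem_univ a), ← Finset.mul_prod_erase _ _ hb, ← mul_assoc,
    ← mul_assoc, h]
  congr 1
  refine Finset.prod_congr rfl fun i hi => ?_
  simp only [Finset.mem_erase] at hi
  exact h' i hi.2.1 hi.1

variable [LinearOrder V]

/-- The greedy part `u ≤ n` of given total `q`, which exhausts `n` at every place before its last
nonzero value. -/
theorem exists_greedy (n : V → ℕ) (q : ℕ) (hq : q ≤ ∑ j, n j) :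
    ∃ u : V → ℕ, u ≤ n ∧ ∑ j, u j = q ∧ ∀ j k, j < k → 0 < u k → u j = n j := by
  induction q with
  | zero => exact ⟨0, fun _ => Nat.zero_le _, by simp, by simp⟩
  | succ q ih =>
    obtain ⟨u, hun, hsum, hu⟩ := ih (by omega)
    have hne : (Finset.univ.filter fun j => u j < n j).Nonempty := by
      by_contra h
      rw [Finset.not_nonempty_iff_eq_empty, Finset.filter_eq_empty_iff] at h
      have : ∑ j, n j ≤ ∑ j, u j := Finset.sum_le_sum fun j hj => not_lt.1 (h hj)
      omega
    obtain ⟨j, hj, hmin⟩ := Finset.exists_minimal hne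
    simp only [Finset.mem_filter, Finset.mem_univ, true_and] at hj hmin
    have hmin' : ∀ i, i < j → u i = n i := fun i hi => by
      by_contra h
      exact not_le_of_gt hi (hmin (lt_of_le_of_ne (hun i) h) hi.le)
    refine ⟨u + Pi.single j 1, fun i => ?_, ?_, fun i k hik hk => ?_⟩
    · by_cases hi : i = j
      · subst hi; simpa using hj
      · simpa [hi] using hun i
    · simp [Finset.sum_add_distrib, hsum]
    · by_cases hkj : k = j
      · subst hkj
        simpa [hik.ne] using hmin' i hik
      · have h1 := hu i k hik (by simpa [hkj] using hk)
        have hij : i ≠ j := by rintro rfl; omega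
        simpa [hij] using h1

/-- A greedy part is determined by its total. -/
theorem greedy_unique {n u v : V → ℕ} (hun : u ≤ n) (hvn : v ≤ n) (hsum : ∑ j, u j = ∑ j, v j)
    (hu : ∀ j k, j < k → 0 < u k → u j = n j) (hv : ∀ j k, j < k → 0 < v k → v j = n j) :
    u = v := by
  by_contra hne
  obtain ⟨j, hj⟩ : ∃ j, u j < v j := by
    by_contra! h
    refine hne (funext fun j => ?_)
    by_contra hj
    have : ∑ j, v j < ∑ j, u j := Finset.sum_lt_sum (fun j _ => h j)
      ⟨j, Finset.mem_univ j, lt_of_le_of_ne (h j) (Ne.symm hj)⟩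
    omega
  obtain ⟨k, hk⟩ : ∃ j, v j < u j := by
    by_contra! h
    have : ∑ j, u j < ∑ j, v j := Finset.sum_lt_sum (fun j _ => h j) ⟨j, Finset.mem_univ j, hj⟩
    omega
  have h1 : u k ≤ n k := hun k
  have h2 : v j ≤ n j := hvn j
  rcases lt_trichotomy j k with h | h | h
  · have := hu j k h (by omega)
    omega
  · subst h; omega
  · have := hv k j h (by omega)
    omega

/-- The matrix `M` of multiplicities describes a noncrossing system of arcs of degrees `d`: the
number of arcs joining `i < j` is `M i j`, and `M` vanishes elsewhere. -/
structure IsArcSystem (d : V → ℕ) (M : V → V → ℕ) : Prop where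
  lt_of_pos : ∀ {i j}, 0 < M i j → i < j
  noncrossing : ∀ {i k j l}, i < k → k < j → j < l → 0 < M i j → 0 < M k l → False
  degree : ∀ i, ∑ j, M i j + ∑ j, M j i = d i

/-- `a < b` are the first two vertices of positive degree. -/
structure AreFirst (d : V → ℕ) (a b : V) : Prop where
  lt : a < b
  left_pos : 0 < d a
  right_pos : 0 < d b
  cases : ∀ i, 0 < d i → i = a ∨ i = b ∨ b < i

theorem sum_mergeRows {a b : V} (hab : a ≠ b) (M : V → V → ℕ) (j : V) :
    ∑ i, mergeRows a b M i j = ∑ i, M i j :=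
  sum_congr_of_add_eq hab (by simp [mergeRows_left, mergeRows_right hab])
    fun i ha hb => by rw [mergeRows_of_ne ha hb]

namespace IsArcSystem

variable {d : V → ℕ} {M : V → V → ℕ} {a b : V}

theorem degree_pos_left (h : IsArcSystem d M) {i j : V} (hij : 0 < M i j) : 0 < d i := by
  have h1 := h.degree i
  have h2 : M i j ≤ ∑ j, M i j := Finset.single_le_sum (f := fun j => M i j)
    (fun _ _ => Nat.zero_le _) (Finset.mem_univ j)
  omega

theorem degree_pos_right (h : IsArcSystem d M) {i j : V} (hij : 0 < M i j) : 0 < d j := by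
  have h1 := h.degree j
  have h2 : M i j ≤ ∑ i, M i j := Finset.single_le_sum (f := fun i => M i j)
    (fun _ _ => Nat.zero_le _) (Finset.mem_univ i)
  omega

/-- An arc between the first two vertices crosses no arc, so it can be added or removed freely. -/
theorem add_singleArc_iff (hab : AreFirst (d + (Pi.single a 1 + Pi.single b 1)) a b) :
    IsArcSystem (d + (Pi.single a 1 + Pi.single b 1)) (M + singleArc a b) ↔ IsArcSystem d M := by
  have hsum1 : ∀ i, ∑ j, singleArc a b i j = (Pi.single a 1 : V → ℕ) i := fun i => by
    by_cases hi : i = a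
    · subst hi; simp [singleArc]
    · simp [singleArc, hi]
  have hsum2 : ∀ i, ∑ j, singleArc a b j i = (Pi.single b 1 : V → ℕ) i := fun i => by
    by_cases hi : i = b
    · subst hi; simp [singleArc_apply]
    · simp [singleArc_apply, hi]
  have hdeg : (∀ i, ∑ j, (M + singleArc a b) i j + ∑ j, (M + singleArc a b) j i =
      (d + (Pi.single a 1 + Pi.single b 1) : V → ℕ) i) ↔ ∀ i, ∑ j, M i j + ∑ j, M j i = d i := by
    refine forall_congr' fun i => ?_
    simp only [Pi.add_apply, Finset.sum_add_distrib, hsum1, hsum2]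
    omega
  have hle : ∀ i j, M i j ≤ (M + singleArc a b) i j := fun i j => Nat.le_add_right _ _
  have hpos : ∀ {i j}, 0 < (M + singleArc a b) i j → (i = a ∧ j = b) ∨ 0 < M i j := by
    intro i j hij
    by_cases h : i = a ∧ j = b
    · exact Or.inl h
    · right
      simpa [singleArc_apply, h] using hij
  constructor
  · intro h
    exact ⟨fun hij => h.lt_of_pos (hij.trans_le (hle _ _)),
      fun h1 h2 h3 hij hkl => h.noncrossing h1 h2 h3 (hij.trans_le (hle _ _))
        (hkl.trans_le (hle _ _)), hdeg.1 h.degree⟩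
  · intro h
    have hd : ∀ {i}, 0 < d i → i = a ∨ i = b ∨ b < i := fun {i} hi =>
      hab.cases i (hi.trans_le (Nat.le_add_right _ _))
    have hlt := hab.lt
    refine ⟨fun hij => ?_, fun {i k j l} h1 h2 h3 hij hkl => ?_, hdeg.2 h.degree⟩
    · rcases hpos hij with ⟨rfl, rfl⟩ | h'
      · exact hlt
      · exact h.lt_of_pos h'
    · rcases hpos hij with ⟨rfl, rfl⟩ | hij' <;> rcases hpos hkl with ⟨rfl, rfl⟩ | hkl'
      · exact h1.false
      · rcases hd (h.degree_pos_left hkl') with rfl | rfl | h4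
        · exact h1.false
        · exact h2.false
        · exact (h2.trans h4).false
      · rcases hd (h.degree_pos_left hij') with rfl | rfl | h4
        · exact h1.false
        · exact (h1.trans hlt).false
        · exact (h1.trans (hlt.trans h4)).false
      · exact h.noncrossing h1 h2 h3 hij' hkl'

theorem left_column (h : IsArcSystem d M) (hab : AreFirst d a b) (i : V) : M i a = 0 := by
  by_contra hne
  have hp := Nat.pos_of_ne_zero hne
  have h1 := h.lt_of_pos hp
  rcases hab.cases i (h.degree_pos_left hp) with rfl | rfl | h4
  · exact h1.false
  · exact (h1.trans hab.lt).false
  · exact (h1.trans (hab.lt.trans h4)).false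

theorem right_column (h : IsArcSystem d M) (hab : AreFirst d a b) (h0 : M a b = 0) (i : V) :
    M i b = 0 := by
  by_contra hne
  have hp := Nat.pos_of_ne_zero hne
  have h1 := h.lt_of_pos hp
  rcases hab.cases i (h.degree_pos_left hp) with rfl | rfl | h4
  · exact hne h0
  · exact h1.false
  · exact (h1.trans h4).false

theorem sum_left (h : IsArcSystem d M) (hab : AreFirst d a b) : ∑ j, M a j = d a := by
  have := h.degree a
  simpa [h.left_column hab] using this

theorem sum_right (h : IsArcSystem d M) (hab : AreFirst d a b) (h0 : M a b = 0) :
    ∑ j, M b j = d b := by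
  have := h.degree b
  simpa [h.right_column hab h0] using this

/-- In the row of `b` the arcs of a noncrossing system take the nearest possible ends. -/
theorem row_eq (h : IsArcSystem d M) (hab : AreFirst d a b) (h0 : M a b = 0) (j k : V)
    (hjk : j < k) (hk : 0 < M b k) : M b j = (M a + M b) j := by
  suffices M a j = 0 by simp [this]
  by_contra hne
  have hp := Nat.pos_of_ne_zero hne
  rcases hab.cases j (h.degree_pos_right hp) with rfl | rfl | h4
  · exact (h.lt_of_pos hp).false
  · exact hne h0
  · exact h.noncrossing hab.lt h4 hjk hp hk

/-- Without an arc from `a` to `b`, a system is determined by the system in which `a` is merged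
into `b`, because row `b` is the greedy part of the merged row. -/
theorem eq_of_mergeRows_eq {M' : V → V → ℕ} (h : IsArcSystem d M) (h' : IsArcSystem d M')
    (hab : AreFirst d a b) (h0 : M a b = 0) (h0' : M' a b = 0)
    (heq : mergeRows a b M = mergeRows a b M') : M = M' := by
  have hne := hab.lt.ne
  have hrow : M a + M b = M' a + M' b := by
    have := congrFun heq b
    rwa [mergeRows_right hne, mergeRows_right hne] at this
  have hb : M b = M' b := by
    refine greedy_unique (n := M a + M b) (fun j => Nat.le_add_left _ _) ?_ ?_
      (h.row_eq hab h0) ?_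
    · rw [hrow]
      exact fun j => Nat.le_add_left _ _
    · rw [h.sum_right hab h0, h'.sum_right hab h0']
    · rw [hrow]
      exact h'.row_eq hab h0'
  funext i
  by_cases hia : i = a
  · subst hia
    rw [hb] at hrow
    exact add_right_cancel hrow
  by_cases hib : i = b
  · rw [hib, hb]
  · have := congrFun heq i
    rwa [mergeRows_of_ne hia hib, mergeRows_of_ne hia hib] at this

theorem mergeRows (h : IsArcSystem d M) (hab : AreFirst d a b) (h0 : M a b = 0) :
    IsArcSystem (Function.update (Function.update d a 0) b (d a + d b))
      (SLTwoInvariants.mergeRows a b M) := by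
  have hne := hab.lt.ne
  have hpos : ∀ {i j}, 0 < SLTwoInvariants.mergeRows a b M i j →
      b < j ∧ ((i = b ∧ (0 < M a j ∨ 0 < M b j)) ∨ (b < i ∧ 0 < M i j)) := by
    intro i j hij
    have hj : ∀ {i}, 0 < M i j → b < j := fun {i} hp => by
      rcases hab.cases j (h.degree_pos_right hp) with rfl | rfl | h4
      · rw [h.left_column hab] at hp; omega
      · rw [h.right_column hab h0] at hp; omega
      · exact h4
    by_cases hia : i = a
    · subst hia; simp [mergeRows_left] at hij
    by_cases hib : i = b
    · subst hib
      rw [mergeRows_right hne, Pi.add_apply] at hij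
      have : 0 < M a j ∨ 0 < M i j := by omega
      exact ⟨this.elim hj hj, Or.inl ⟨rfl, this⟩⟩
    · rw [mergeRows_of_ne hia hib] at hij
      refine ⟨hj hij, Or.inr ⟨?_, hij⟩⟩
      rcases hab.cases i (h.degree_pos_left hij) with h4 | h4 | h4
      · exact (hia h4).elim
      · exact (hib h4).elim
      · exact h4
  refine ⟨fun {i j} hij => ?_, fun {i k j l} h1 h2 h3 hij hkl => ?_, fun i => ?_⟩
  · rcases hpos hij with ⟨h1, ⟨rfl, -⟩ | ⟨-, h2⟩⟩
    · exact h1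
    · exact h.lt_of_pos h2
  · rcases hpos hkl with ⟨-, ⟨rfl, -⟩ | ⟨h5, h6⟩⟩
    · rcases hpos hij with ⟨-, ⟨rfl, -⟩ | ⟨h5, -⟩⟩
      · exact h1.false
      · exact (h1.trans h5).false
    · rcases hpos hij with ⟨-, ⟨rfl, h7 | h7⟩ | ⟨-, h7⟩⟩
      · exact h.noncrossing (hab.lt.trans h1) h2 h3 h7 h6
      · exact h.noncrossing h1 h2 h3 h7 h6
      · exact h.noncrossing h1 h2 h3 h7 h6
  · rw [sum_mergeRows hne]
    by_cases hib : i = b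
    · subst hib
      simp [mergeRows_right hne, Finset.sum_add_distrib, h.sum_left hab, h.sum_right hab h0,
        h.right_column hab h0]
    by_cases hia : i = a
    · subst hia
      simp [mergeRows_left, h.left_column hab, hne]
    · rw [mergeRows_of_ne hia hib, Function.update_of_ne hib, Function.update_of_ne hia]
      exact h.degree i

/-- Every system of the merged degrees comes from a system without an arc from `a` to `b`: row `b`
is the greedy part, of total `d b`, of the merged row, and row `a` is the rest. -/
theorem exists_mergeRows_eq {H : V → V → ℕ} (hab : AreFirst d a b)
    (h : IsArcSystem (Function.update (Function.update d a 0) b (d a + d b)) H) :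
    ∃ M, IsArcSystem d M ∧ M a b = 0 ∧ SLTwoInvariants.mergeRows a b M = H := by
  have hne := hab.lt.ne
  have hd : ∀ {i}, 0 < Function.update (Function.update d a 0) b (d a + d b) i →
      i = b ∨ b < i := by
    intro i hi
    by_cases hib : i = b
    · exact Or.inl hib
    by_cases hia : i = a
    · simp [hia, hne] at hi
    rw [Function.update_of_ne hib, Function.update_of_ne hia] at hi
    exact (hab.cases i hi).resolve_left hia
  have hHleft : ∀ {i j}, 0 < H i j → i = b ∨ b < i := fun hp => hd (h.degree_pos_left hp)
  have hHright : ∀ {i j}, 0 < H i j → b < j := fun hp => (hHleft hp).elim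
    (fun h1 => h1 ▸ h.lt_of_pos hp) fun h1 => h1.trans (h.lt_of_pos hp)
  have hcol : ∀ {j}, ¬ b < j → ∀ i, H i j = 0 := fun hj i => by
    by_contra hp
    exact hj (hHright (Nat.pos_of_ne_zero hp))
  have hrow : H a = 0 := by
    funext j
    by_contra hp
    rcases hHleft (Nat.pos_of_ne_zero hp) with h1 | h1
    · exact hne h1
    · exact (h1.trans hab.lt).false
  have hsum : ∑ j, H b j = d a + d b := by
    have := h.degree b
    simpa [hcol (lt_irrefl b)] using this
  obtain ⟨u, hun, husum, hu⟩ := exists_greedy (H b) (d b) (by omega)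
  let M : V → V → ℕ := fun i => if i = a then H b - u else if i = b then u else H i
  have hMa : M a = H b - u := by simp [M]
  have hMb : M b = u := by simp [M, hne.symm]
  have hMi : ∀ {i}, i ≠ a → i ≠ b → M i = H i := fun ha hb => by simp [M, ha, hb]
  have hmerge : SLTwoInvariants.mergeRows a b M = H := by
    funext i
    by_cases hia : i = a
    · subst hia; rw [mergeRows_left, hrow]
    by_cases hib : i = b
    · subst hib
      rw [mergeRows_right hne, hMa, hMb]
      exact tsub_add_cancel_of_le hun
    · rw [mergeRows_of_ne hia hib, hMi hia hib]
  have hpos : ∀ {i j}, 0 < M i j → 0 < H (Function.update id a b i) j := fun hp => by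
    have := mergeRows_pos hne hp
    rwa [hmerge] at this
  have hposleft : ∀ {i j}, 0 < M i j → i = a ∨ i = b ∨ b < i := fun {i j} hp => by
    by_cases hia : i = a
    · exact Or.inl hia
    · have := hHleft (hpos hp)
      rw [Function.update_of_ne hia] at this
      exact Or.inr this
  have hMcol : ∀ {j}, ¬ b < j → ∀ i, M i j = 0 := fun hj i => by
    by_contra hp
    exact hj (hHright (hpos (Nat.pos_of_ne_zero hp)))
  refine ⟨M, ⟨fun {i j} hij => ?_, fun {i k j l} h1 h2 h3 hij hkl => ?_, fun i => ?_⟩,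
    hMcol (lt_irrefl b) a, hmerge⟩
  · have h1 := h.lt_of_pos (hpos hij)
    by_cases hia : i = a
    · subst hia
      rw [Function.update_self] at h1
      exact hab.lt.trans h1
    · rwa [Function.update_of_ne hia] at h1
  · have hk : k ≠ a := by
      rintro rfl
      rcases hposleft hij with rfl | rfl | h4
      · exact h1.false
      · exact (h1.trans hab.lt).false
      · exact (h1.trans (hab.lt.trans h4)).false
    by_cases hia : i = a
    · subst hia
      by_cases hkb : k = b
      · subst hkb
        rw [hMa, Pi.sub_apply] at hij
        rw [hMb] at hkl
        have := hu j l h3 hkl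
        omega
      · have h4 := hpos hij
        have h5 := hpos hkl
        rw [Function.update_self] at h4
        rw [Function.update_of_ne hk] at h5
        exact h.noncrossing (((hposleft hkl).resolve_left hk).resolve_left hkb) h2 h3 h4 h5
    · have h4 := hpos hij
      have h5 := hpos hkl
      rw [Function.update_of_ne hia] at h4
      rw [Function.update_of_ne hk] at h5
      exact h.noncrossing h1 h2 h3 h4 h5
  · by_cases hia : i = a
    · subst hia
      have h1 : ∑ j, (H b - u) j + ∑ j, u j = ∑ j, H b j := by
        rw [← Finset.sum_add_distrib]
        exact Finset.sum_congr rfl fun j _ => tsub_add_cancel_of_le (hun j)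
      have h2 : ∑ j, M j i = 0 := Finset.sum_eq_zero fun j _ => hMcol hab.lt.not_gt j
      rw [hMa, h2]
      omega
    by_cases hib : i = b
    · subst hib
      have h2 : ∑ j, M j i = 0 := Finset.sum_eq_zero fun j _ => hMcol (lt_irrefl i) j
      rw [hMb, h2]
      omega
    · have h1 := h.degree i
      rw [Function.update_of_ne hib, Function.update_of_ne hia, ← hmerge, sum_mergeRows hne,
        mergeRows_of_ne hia hib] at h1
      exact h1

/-- With at most one vertex of positive degree there are no arcs. -/
theorem eq_zero (h : IsArcSystem d M) (hd : ∀ i j, 0 < d i → 0 < d j → i = j) : M = 0 := by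
  funext i j
  by_contra hne
  have hp := Nat.pos_of_ne_zero hne
  exact (h.lt_of_pos hp).ne (hd i j (h.degree_pos_left hp) (h.degree_pos_right hp))

end IsArcSystem

end Combinatorics

end SLTwoInvariants

/-! ### The basis of bracket monomials -/

namespace SLTwoInvariants

open MvPolynomial

/-- If `R` kills `v` on `S`, then independence of `v` on `S` and of `R ∘ v` off `S` gives
independence of `v`. -/
theorem linearIndependent_of_map {K E E' ι : Type*} [Field K] [AddCommGroup E] [Module K E]
    [AddCommGroup E'] [Module K E'] {v : ι → E} (R : E →ₗ[K] E') (S : Set ι)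
    (hS : LinearIndepOn K v S) (hS' : LinearIndepOn K (R ∘ v) Sᶜ) (h0 : ∀ i ∈ S, R (v i) = 0) :
    LinearIndependent K v := by
  classical
  rw [linearIndependent_iff']
  intro s g hg
  have h1 : ∀ i ∈ s, i ∉ S → g i = 0 := by
    have h2 : ∑ i ∈ s.filter (· ∉ S), g i • (R ∘ v) i = 0 := by
      refine ((Finset.sum_filter _ _).trans (Finset.sum_congr rfl fun i _ => ?_)).trans
        ((map_sum R (fun i => g i • v i) s).symm.trans ((congrArg R hg).trans (map_zero R)))
      by_cases hi : i ∈ S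
      · simp only [hi, not_true_eq_false, if_false, map_smul, h0 i hi, smul_zero]
      · simp [hi]
    intro i hi hiS
    exact linearIndepOn_iff'.1 hS' (s.filter (· ∉ S)) g
      (fun i hi => (Finset.mem_filter.1 hi).2) h2 i (Finset.mem_filter.2 ⟨hi, hiS⟩)
  have h3 : ∑ i ∈ s.filter (· ∈ S), g i • v i = 0 := by
    refine (Finset.sum_filter _ _).trans (Eq.trans ?_ hg)
    refine Finset.sum_congr rfl fun i hi => ?_
    by_cases hiS : i ∈ S
    · simp [hiS]
    · simp [hiS, h1 i hi hiS]
  intro i hi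
  by_cases hiS : i ∈ S
  · exact linearIndepOn_iff'.1 hS (s.filter (· ∈ S)) g
      (fun i hi => (Finset.mem_filter.1 hi).2) h3 i (Finset.mem_filter.2 ⟨hi, hiS⟩)
  · exact h1 i hi hiS

section

variable {F : Type*} [Field F] {V : Type*} [Fintype V]

variable (F) in
/-- The product of the brackets of all the arcs of `M`. -/
noncomputable def bracketProd (M : V → V → ℕ) : MvPolynomial (V × Fin 2) F :=
  ∏ i, ∏ j, bracket F i j ^ M i j

theorem isSLInvariant_bracketProd (M : V → V → ℕ) : IsSLInvariant (bracketProd F M) :=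
  IsSLInvariant.prod fun i _ => IsSLInvariant.prod fun j _ => (isSLInvariant_bracket i j).pow _

variable [LinearOrder V] {d : V → ℕ} {M : V → V → ℕ} {a b : V}

theorem IsArcSystem.isMultihomogeneous_bracketProd (h : IsArcSystem d M) :
    IsMultihomogeneous d (bracketProd F M) := by
  have h1 : IsMultihomogeneous (∑ i, ∑ j, M i j • (Pi.single i 1 + Pi.single j 1 : V → ℕ))
      (bracketProd F M) :=
    IsMultihomogeneous.prod fun i _ => IsMultihomogeneous.prod fun j _ =>
      isMultihomogeneous_bracket.pow _
  convert h1
  funext k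
  rw [← h.degree k]
  simp [Finset.sum_add_distrib, Pi.single_apply]

theorem IsArcSystem.bracketProd_ne_zero (h : IsArcSystem d M) : bracketProd F M ≠ 0 := by
  refine Finset.prod_ne_zero_iff.2 fun i _ => Finset.prod_ne_zero_iff.2 fun j _ => ?_
  by_cases hij : M i j = 0
  · rw [hij, pow_zero]
    exact one_ne_zero
  · exact pow_ne_zero _ (bracket_ne_zero (h.lt_of_pos (Nat.pos_of_ne_zero hij)).ne)

theorem bracketProd_add_singleArc (M : V → V → ℕ) (a b : V) :
    bracketProd F (M + singleArc a b) = bracket F a b * bracketProd F M := by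
  simp only [bracketProd, Pi.add_apply, pow_add, Finset.prod_mul_distrib]
  rw [mul_comm]
  congr 1
  rw [Finset.prod_eq_single a, Finset.prod_eq_single b] <;>
    simp +contextual [singleArc_apply]

theorem identify_bracketProd_eq_zero (h : M a b ≠ 0) (hab : a ≠ b) :
    identify F a b (bracketProd F M) = 0 := by
  rw [bracketProd, map_prod]
  refine Finset.prod_eq_zero (Finset.mem_univ a) ?_
  rw [map_prod]
  refine Finset.prod_eq_zero (Finset.mem_univ b) ?_
  rw [map_pow, identify_bracket, Function.update_self, Function.update_of_ne hab.symm, id]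
  simp [bracket, h]

theorem IsArcSystem.identify_bracketProd (h : IsArcSystem d M) (hab : AreFirst d a b) :
    identify F a b (bracketProd F M) = bracketProd F (SLTwoInvariants.mergeRows a b M) := by
  have hne := hab.lt.ne
  have hj : ∀ i j, bracket F i (Function.update id a b j) ^ M i j = bracket F i j ^ M i j ∧
      bracket F b (Function.update id a b j) ^ M i j = bracket F b j ^ M i j := by
    intro i j
    by_cases hja : j = a
    · subst hja
      simp [h.left_column hab]
    · simp [Function.update_of_ne hja]
  rw [bracketProd, bracketProd, map_prod]
  refine prod_congr_of_mul_eq hne ?_ fun i hia hib => ?_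
  · rw [mergeRows_left, mergeRows_right hne, map_prod, map_prod, ← Finset.prod_mul_distrib,
      ← Finset.prod_mul_distrib]
    refine Finset.prod_congr rfl fun j _ => ?_
    rw [map_pow, map_pow, identify_bracket, identify_bracket, Function.update_self,
      Function.update_of_ne hne.symm, id, (hj a j).2, (hj b j).2, Pi.zero_apply, pow_zero, one_mul,
      Pi.add_apply, pow_add]
  · rw [mergeRows_of_ne hia hib, map_prod]
    refine Finset.prod_congr rfl fun j _ => ?_
    rw [map_pow, identify_bracket, Function.update_of_ne hia, id, (hj i j).1]

variable (F) in
/-- The bracket monomial of an arc system. -/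
noncomputable def arcMonomial (d : V → ℕ) (M : {M : V → V → ℕ // IsArcSystem d M}) :
    MvPolynomial (V × Fin 2) F :=
  bracketProd F M.1

variable (F) in
/-- The span of the bracket monomials of degrees `d`. -/
noncomputable def arcSpan (d : V → ℕ) : Submodule F (MvPolynomial (V × Fin 2) F) :=
  Submodule.span F (Set.range (arcMonomial F d))

theorem IsArcSystem.mem_arcSpan (h : IsArcSystem d M) : bracketProd F M ∈ arcSpan F d :=
  Submodule.subset_span ⟨⟨M, h⟩, rfl⟩

theorem arcSpan_le {P : Submodule F (MvPolynomial (V × Fin 2) F)}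
    (h : ∀ M, IsArcSystem d M → bracketProd F M ∈ P) : arcSpan F d ≤ P :=
  Submodule.span_le.2 (Set.range_subset_iff.2 fun M => h M.1 M.2)

theorem isMultihomogeneous_of_mem_arcSpan {f : MvPolynomial (V × Fin 2) F}
    (hf : f ∈ arcSpan F d) : IsMultihomogeneous d f :=
  arcSpan_le (P := IsMultihomogeneous.submodule F d)
    (fun _ hM => hM.isMultihomogeneous_bracketProd) hf

theorem isSLInvariant_of_mem_arcSpan {f : MvPolynomial (V × Fin 2) F}
    (hf : f ∈ arcSpan F d) : IsSLInvariant f :=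
  arcSpan_le (P := IsSLInvariant.submodule F V) (fun M _ => isSLInvariant_bracketProd M) hf

variable (F) in
/-- The bracket monomials of the arc systems of degrees `d` are linearly independent and span the
multihomogeneous invariants of degrees `d`. -/
def BracketBasis (d : V → ℕ) : Prop :=
  LinearIndependent F (arcMonomial F d) ∧
    ∀ f : MvPolynomial (V × Fin 2) F, IsMultihomogeneous d f → IsSLInvariant f → f ∈ arcSpan F d

theorem bracketBasis_of_subsingleton [CharZero F] (hd : ∀ i j, 0 < d i → 0 < d j → i = j) :
    BracketBasis F d := by
  constructor
  · have : Subsingleton {M : V → V → ℕ // IsArcSystem d M} :=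
      ⟨fun M N => Subtype.ext ((M.2.eq_zero hd).trans (N.2.eq_zero hd).symm)⟩
    rw [linearIndependent_subsingleton_index_iff]
    exact fun M => M.2.bracketProd_ne_zero
  · intro f hf hinv
    by_cases ha : ∃ a, d a ≠ 0
    · obtain ⟨a, ha⟩ := ha
      rw [hf.eq_zero_of_isSLInvariant hinv ha fun i hi => by
        by_contra hdi
        exact hi (hd i a (Nat.pos_of_ne_zero hdi) (Nat.pos_of_ne_zero ha))]
      exact zero_mem _
    · push Not at ha
      have h0 : IsArcSystem d (0 : V → V → ℕ) := ⟨by simp, by simp, by simp [ha]⟩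
      have : f = eval 0 f • bracketProd F (0 : V → V → ℕ) := by
        rw [bracketProd]
        simpa [smul_eq_C_mul] using hf.eq_C ha
      rw [this]
      exact Submodule.smul_mem _ _ h0.mem_arcSpan

/-- The arc systems with an arc from `a` to `b` correspond to the arc systems for the degrees
lowered by one at `a` and `b`, so their independence follows by cancelling a bracket. -/
theorem linearIndepOn_arcMonomial (hab : AreFirst (d + (Pi.single a 1 + Pi.single b 1)) a b)
    (h1 : LinearIndependent F (arcMonomial F d)) :
    LinearIndepOn F (arcMonomial F (d + (Pi.single a 1 + Pi.single b 1)))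
      {M | M.1 a b ≠ 0} := by
  have hne := hab.lt.ne
  have key : ∀ M : ({M | M.1 a b ≠ 0} :
      Set {M : V → V → ℕ // IsArcSystem (d + (Pi.single a 1 + Pi.single b 1)) M}),
      ∃ N : {N : V → V → ℕ // IsArcSystem d N}, M.1.1 = N.1 + singleArc a b := by
    rintro ⟨⟨M, hM⟩, h0⟩
    have hM' : M = M - singleArc a b + singleArc a b := by
      funext i j
      by_cases hij : i = a ∧ j = b
      · obtain ⟨rfl, rfl⟩ := hij
        have h0 : M i j ≠ 0 := h0
        simp [singleArc_apply]
        omega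
      · simp [singleArc_apply, hij]
    rw [hM'] at hM
    exact ⟨⟨_, (IsArcSystem.add_singleArc_iff hab).1 hM⟩, hM'⟩
  choose N hN using key
  have hinj : Function.Injective N := fun M M' h =>
    Subtype.ext (Subtype.ext (by rw [hN, hN, h]))
  have := (h1.comp N hinj).map' (LinearMap.mulLeft F (bracket F a b))
    (LinearMap.ker_eq_bot.2 (mul_right_injective₀ (bracket_ne_zero hne)))
  have hfun : (fun M : ({M | M.1 a b ≠ 0} :
      Set {M : V → V → ℕ // IsArcSystem (d + (Pi.single a 1 + Pi.single b 1)) M}) =>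
      arcMonomial F _ M.1) = LinearMap.mulLeft F (bracket F a b) ∘ arcMonomial F d ∘ N :=
    funext fun M => (congrArg (bracketProd F) (hN M)).trans (bracketProd_add_singleArc _ a b)
  rw [← hfun] at this
  exact this

/-- The arc systems without an arc from `a` to `b` correspond to the arc systems for the degrees in
which `a` is merged into `b`, and so do the specializations of their bracket monomials. -/
theorem linearIndepOn_identify_arcMonomial (hab : AreFirst d a b)
    (h2 : LinearIndependent F
      (arcMonomial F (Function.update (Function.update d a 0) b (d a + d b)))) :
    LinearIndepOn F ((identify F a b).toLinearMap ∘ arcMonomial F d) {M | M.1 a b ≠ 0}ᶜ := by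
  have hc : ∀ M : ({M | M.1 a b ≠ 0}ᶜ : Set {M : V → V → ℕ // IsArcSystem d M}),
      M.1.1 a b = 0 := fun M => not_not.1 M.2
  let N : ({M | M.1 a b ≠ 0}ᶜ : Set {M : V → V → ℕ // IsArcSystem d M}) →
      {N // IsArcSystem (Function.update (Function.update d a 0) b (d a + d b)) N} := fun M =>
    ⟨mergeRows a b M.1.1, M.1.2.mergeRows hab (hc M)⟩
  have hinj : Function.Injective N := fun M M' h =>
    Subtype.ext (Subtype.ext (M.1.2.eq_of_mergeRows_eq M'.1.2 hab (hc M) (hc M')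
      (congrArg Subtype.val h)))
  have := h2.comp N hinj
  have hfun : (fun M : ({M | M.1 a b ≠ 0}ᶜ : Set {M : V → V → ℕ // IsArcSystem d M}) =>
      ((identify F a b).toLinearMap ∘ arcMonomial F d) M.1) = arcMonomial F _ ∘ N :=
    funext fun M => M.1.2.identify_bracketProd hab
  rw [← hfun] at this
  exact this

/-- On the side of invariants, the specialization `(x_a, y_a) := (x_b, y_b)` maps onto the
invariants of the merged degrees, and its kernel is divisible by the bracket of `a` and `b`. -/
theorem mem_arcSpan_of_first [Infinite F]
    (hab : AreFirst (d + (Pi.single a 1 + Pi.single b 1)) a b)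
    (h1 : ∀ f : MvPolynomial (V × Fin 2) F, IsMultihomogeneous d f → IsSLInvariant f →
      f ∈ arcSpan F d)
    {f : MvPolynomial (V × Fin 2) F}
    (hf : IsMultihomogeneous (d + (Pi.single a 1 + Pi.single b 1)) f) (hinv : IsSLInvariant f)
    {d' : V → ℕ} (hd' : d' = Function.update
      (Function.update (d + (Pi.single a 1 + Pi.single b 1)) a 0) b
      ((d + (Pi.single a 1 + Pi.single b 1) : V → ℕ) a +
        (d + (Pi.single a 1 + Pi.single b 1) : V → ℕ) b))
    (h2 : identify F a b f ∈ arcSpan F d') :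
    f ∈ arcSpan F (d + (Pi.single a 1 + Pi.single b 1)) := by
  have hne := hab.lt.ne
  obtain ⟨f₁, hf₁, hR⟩ : ∃ f₁ ∈ arcSpan F (d + (Pi.single a 1 + Pi.single b 1)),
      (identify F a b).toLinearMap f₁ = identify F a b f := by
    rw [← Submodule.mem_map]
    refine arcSpan_le (fun H hH => ?_) h2
    rw [hd'] at hH
    obtain ⟨M, hM, -, rfl⟩ := hH.exists_mergeRows_eq hab
    exact ⟨_, hM.mem_arcSpan, hM.identify_bracketProd hab⟩
  have hgh := hf.sub (isMultihomogeneous_of_mem_arcSpan hf₁)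
  have hgi := hinv.sub (isSLInvariant_of_mem_arcSpan hf₁)
  obtain ⟨g, hg⟩ := hgh.bracket_dvd hne (by
    rw [map_sub, sub_eq_zero]
    exact hR.symm)
  rw [hg] at hgh hgi
  have hmem := h1 g (hgh.of_bracket_mul hne) (hgi.of_bracket_mul hne)
  have hle : arcSpan F d ≤ (arcSpan F (d + (Pi.single a 1 + Pi.single b 1))).comap
      (LinearMap.mulLeft F (bracket F a b)) := arcSpan_le fun M hM => by
    rw [Submodule.mem_comap, LinearMap.mulLeft_apply, ← bracketProd_add_singleArc]
    exact ((IsArcSystem.add_singleArc_iff hab).2 hM).mem_arcSpan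
  have hfg : bracket F a b * g ∈ arcSpan F (d + (Pi.single a 1 + Pi.single b 1)) := hle hmem
  rw [← hg] at hfg
  simpa using add_mem hfg hf₁

theorem exists_areFirst (h : ¬ ∀ i j, 0 < d i → 0 < d j → i = j) : ∃ a b, AreFirst d a b := by
  push Not at h
  obtain ⟨i₀, j₀, hi₀, hj₀, hij⟩ := h
  obtain ⟨a, ha, hamin⟩ := Finset.exists_min_image (Finset.univ.filter fun i => 0 < d i) id
    ⟨i₀, by simpa using hi₀⟩
  have hne' : (Finset.univ.filter fun i => i ≠ a ∧ 0 < d i).Nonempty := by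
    by_cases h : i₀ = a
    · exact ⟨j₀, by simpa using ⟨fun h' => hij (h.trans h'.symm), hj₀⟩⟩
    · exact ⟨i₀, by simpa using ⟨h, hi₀⟩⟩
  obtain ⟨b, hb, hbmin⟩ := Finset.exists_min_image _ id hne'
  simp only [Finset.mem_filter, Finset.mem_univ, true_and, id] at ha hamin hb hbmin
  refine ⟨a, b, lt_of_le_of_ne (hamin b hb.2) hb.1.symm, ha, hb.2, fun i hi => ?_⟩
  by_cases hia : i = a
  · exact Or.inl hia
  · exact Or.inr ((hbmin i ⟨hia, hi⟩).eq_or_lt.imp Eq.symm id)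

/-- Induction on the sum of the degrees plus the number of vertices of positive degree, which drops
both when the degrees of `a` and `b` are lowered and when `a` is merged into `b`. -/
theorem bracketBasis [CharZero F] (d : V → ℕ) : BracketBasis F d := by
  induction hn : ∑ i, d i + (Finset.univ.filter fun i => 0 < d i).card using
    Nat.strong_induction_on generalizing d with
  | _ n ih =>
    by_cases hsupp : ∀ i j, 0 < d i → 0 < d j → i = j
    · exact bracketBasis_of_subsingleton hsupp
    obtain ⟨a, b, hab⟩ := exists_areFirst hsupp
    have hne := hab.lt.ne
    have hmerge : BracketBasis F (Function.update (Function.update d a 0) b (d a + d b)) := by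
      refine ih _ ?_ _ rfl
      rw [← hn]
      refine add_lt_add_of_le_of_lt (le_of_eq ?_) (Finset.card_lt_card ?_)
      · refine sum_congr_of_add_eq hne ?_ fun i hia hib => ?_
        · simp [hne]
        · rw [Function.update_of_ne hib, Function.update_of_ne hia]
      · rw [Finset.ssubset_iff_of_subset]
        · exact ⟨a, by simpa using hab.left_pos, by simp [hne]⟩
        · intro i hi
          by_cases hib : i = b
          · subst hib; simpa using hab.right_pos
          by_cases hia : i = a
          · subst hia; simpa using hab.left_pos
          simpa [Function.update_of_ne hib, Function.update_of_ne hia] using hi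
    obtain ⟨d₀, rfl⟩ : ∃ d₀ : V → ℕ, d = d₀ + (Pi.single a 1 + Pi.single b 1) := by
      refine ⟨d - (Pi.single a 1 + Pi.single b 1), funext fun i => ?_⟩
      have := hab.left_pos
      have := hab.right_pos
      by_cases hia : i = a
      · subst hia; simp [hne]; omega
      by_cases hib : i = b
      · subst hib; simp [hia]; omega
      simp [hia, hib]
    have hlower : BracketBasis F d₀ := by
      refine ih _ ?_ _ rfl
      rw [← hn]
      refine add_lt_add_of_lt_of_le ?_ (Finset.card_le_card fun i hi => ?_)
      · simp [Finset.sum_add_distrib]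
      · simp only [Finset.mem_filter, Finset.mem_univ, true_and] at hi ⊢
        exact hi.trans_le (Nat.le_add_right _ _)
    exact ⟨linearIndependent_of_map (identify F a b).toLinearMap {M | M.1 a b ≠ 0}
      (linearIndepOn_arcMonomial hab hlower.1) (linearIndepOn_identify_arcMonomial hab hmerge.1)
      fun M hM => identify_bracketProd_eq_zero hM hne,
      fun f hf hinv => mem_arcSpan_of_first hab hlower.2 hf hinv rfl
        (hmerge.2 _ (hf.identify hne) (hinv.identify a b))⟩

end

end SLTwoInvariants

/-! ### Tensors as multihomogeneous polynomials -/

namespace SLTwoInvariants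

open MvPolynomial

section Tensors

variable (F : Type*) [Field F]

/-- The monomial basis of `S^n V`. -/
noncomputable def symPowBasis (n : ℕ) :
    Module.Basis ({e : Fin 2 →₀ ℕ | e.degree = n} : Set (Fin 2 →₀ ℕ)) F (SymPow F n) :=
  Module.Basis.ofRepr ((LinearEquiv.ofEq _ _
    (homogeneousSubmodule_eq_finsupp_supported _ _ n)).trans
    (AddMonoidAlgebra.supportedEquivFinsupp {e : Fin 2 →₀ ℕ | e.degree = n}))

theorem coe_symPowBasis (n : ℕ) (e : ({e : Fin 2 →₀ ℕ | e.degree = n} : Set (Fin 2 →₀ ℕ))) :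
    (symPowBasis F n e : MvPolynomial (Fin 2) F) = monomial e.1 1 := by
  have : symPowBasis F n e = ⟨monomial e.1 1,
      (mem_homogeneousSubmodule _ _).2 (isHomogeneous_monomial _ e.2)⟩ := by
    apply (symPowBasis F n).repr.injective
    rw [Module.Basis.repr_self]
    ext e'
    change _ = coeff e'.1 (monomial e.1 (1 : F))
    simp [coeff_monomial, Finsupp.single_apply, Subtype.ext_iff]
  rw [this]

variable {m : ℕ}

/-- A tensor in `S^{d_1} V ⊗ ⋯ ⊗ S^{d_m} V` as a polynomial in the variables
`x_i = X (i, 0)`, `y_i = X (i, 1)`. -/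
noncomputable def toPoly (d : Fin m → ℕ) :
    (⨂[F] i, SymPow F (d i)) →ₗ[F] MvPolynomial (Fin m × Fin 2) F :=
  PiTensorProduct.lift ((MultilinearMap.mkPiAlgebra F (Fin m) _).compLinearMap fun i =>
    (rename (Prod.mk i)).toLinearMap ∘ₗ Submodule.subtype _)

variable {F} {d : Fin m → ℕ}

theorem toPoly_tprod (p : ∀ i, SymPow F (d i)) :
    toPoly F d (PiTensorProduct.tprod F p) =
      ∏ i, rename (Prod.mk i) (p i : MvPolynomial (Fin 2) F) := by
  simp [toPoly]

theorem eval_mul_of_isHomogeneous {σ : Type*} {n : ℕ} {p : MvPolynomial σ F}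
    (hp : p.IsHomogeneous n) (c : F) (y : σ → F) :
    eval (fun k => c * y k) p = c ^ n * eval y p := by
  rw [eval_eq, eval_eq, Finset.mul_sum]
  refine Finset.sum_congr rfl fun e he => ?_
  have h := hp (mem_support_iff.1 he)
  simp only [mul_pow, Finset.prod_mul_distrib, Finset.prod_pow_eq_pow_sum]
  have h' : ∑ k ∈ e.support, e k = n := by
    rw [← h, ← Finsupp.degree_apply, Finsupp.degree_eq_weight_one]
    rfl
  rw [h']
  ring

theorem isMultihomogeneous_toPoly (t : ⨂[F] i, SymPow F (d i)) :
    IsMultihomogeneous d (toPoly F d t) := by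
  induction t using PiTensorProduct.induction_on with
  | smul_tprod r p =>
    have h : IsMultihomogeneous d (toPoly F d (PiTensorProduct.tprod F p)) := fun c x => by
      simp only [toPoly_tprod, map_prod, eval_rename, ← Finset.prod_mul_distrib]
      exact Finset.prod_congr rfl fun i _ =>
        eval_mul_of_isHomogeneous ((mem_homogeneousSubmodule _ _).1 (p i).2) (c i)
          fun k => x (i, k)
    rw [LinearMap.map_smul]
    exact (IsMultihomogeneous.submodule F d).smul_mem r h
  | add s t hs ht =>
    rw [map_add]
    exact (IsMultihomogeneous.submodule F d).add_mem hs ht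

theorem eval_toPoly_tensorRho (A : SL(2, F)) (x : Fin m × Fin 2 → F) (t : ⨂[F] i, SymPow F (d i)) :
    eval x (toPoly F d (tensorRho F d A t)) = eval (rowMul A x) (toPoly F d t) := by
  induction t using PiTensorProduct.induction_on with
  | smul_tprod r p =>
    have h : tensorRho F d A (PiTensorProduct.tprod F p) =
        PiTensorProduct.tprod F fun i => rho F (d i) A (p i) := PiTensorProduct.map_tprod _ _
    rw [LinearMap.map_smul, LinearMap.map_smul, LinearMap.map_smul, h, toPoly_tprod, toPoly_tprod,
      smul_eval, smul_eval, map_prod, map_prod]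
    congr 1
    refine Finset.prod_congr rfl fun i _ => ?_
    rw [eval_rename, eval_rename]
    change eval _ (substHom _ _) = _
    rw [substHom, eval_aeval]
    simp [rowMul, Function.comp_def]
  | add s t hs ht => simp only [map_add, hs, ht]

/-- The monomial basis is mapped to distinct monomials. -/
theorem toPoly_injective : Function.Injective (toPoly F d) := by
  let B := Basis.piTensorProduct fun i => symPowBasis F (d i)
  let E : (∀ i, ({e : Fin 2 →₀ ℕ | e.degree = d i} : Set (Fin 2 →₀ ℕ))) → (Fin m × Fin 2 →₀ ℕ) :=
    fun e => ∑ i, Finsupp.mapDomain (Prod.mk i) (e i).1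
  have hE : ∀ e i k, E e (i, k) = (e i).1 k := by
    intro e i k
    simp only [E, Finsupp.finsetSum_apply]
    rw [Finset.sum_eq_single i]
    · exact Finsupp.mapDomain_apply (Prod.mk_right_injective i) _ _
    · intro j _ hj
      refine Finsupp.mapDomain_of_notMem_range _ _ ?_
      rintro ⟨k', hk⟩
      exact hj (congrArg Prod.fst hk)
    · simp
  have hEinj : Function.Injective E := fun e e' h => funext fun i =>
    Subtype.ext (Finsupp.ext fun k => by rw [← hE, ← hE, h])
  have hB : ⇑(toPoly F d) ∘ ⇑B = (fun s => monomial s (1 : F)) ∘ E := by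
    funext e
    rw [Function.comp_apply, Basis.piTensorProduct_apply, toPoly_tprod]
    simp only [coe_symPowBasis, rename_monomial, Function.comp_apply, E]
    exact (monomial_sum_one _ _).symm
  have hli : LinearIndependent F (⇑(toPoly F d) ∘ ⇑B) := by
    rw [hB]
    have := (basisMonomials (Fin m × Fin 2) F).linearIndependent.comp E hEinj
    rwa [coe_basisMonomials] at this
  have := B.injective_constr_of_linearIndependent (R₂ := F) hli
  rwa [show B.constr F (⇑(toPoly F d) ∘ ⇑B) = toPoly F d from B.ext fun e => B.constr_basis F _ e]
    at this

theorem mem_invariantTensors_iff (t : ⨂[F] i, SymPow F (d i)) :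
    t ∈ invariantTensors F d ↔ ∀ A, tensorRho F d A t = t :=
  Representation.mem_invariants _ _

theorem mem_invariantTensors_iff_isSLInvariant [Infinite F] (t : ⨂[F] i, SymPow F (d i)) :
    t ∈ invariantTensors F d ↔ IsSLInvariant (toPoly F d t) := by
  rw [mem_invariantTensors_iff]
  refine forall_congr' fun A => ?_
  rw [← toPoly_injective.eq_iff]
  constructor
  · intro h x
    rw [← eval_toPoly_tensorRho, h]
  · intro h
    refine MvPolynomial.funext fun x => ?_
    rw [eval_toPoly_tensorRho, h]

end Tensors

end SLTwoInvariants

/-! ### From graphs to arc systems -/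

namespace SLTwoInvariants

open MvPolynomial

@[to_additive]
theorem prod_sym2_eq {V N : Type*} [Fintype V] [LinearOrder V] [CommMonoid N] (f : Sym2 V → N)
    (hf : ∀ e : Sym2 V, e.IsDiag → f e = 1) :
    ∏ e, f e = ∏ i, ∏ j, if i < j then f s(i, j) else 1 := by
  rw [← Fintype.prod_prod_type' (f := fun i j => if i < j then f s(i, j) else 1),
    ← Finset.prod_filter]
  symm
  refine Finset.prod_of_injOn (fun p : V × V => s(p.1, p.2)) ?_ (by simp) ?_ (fun _ _ => rfl)
  · rintro ⟨i, j⟩ hp ⟨k, l⟩ hq h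
    simp only [Finset.coe_filter, Finset.mem_univ, true_and, Set.mem_ofPred_eq] at hp hq
    rcases Sym2.eq_iff.1 h with h | h
    · exact Prod.ext h.1 h.2
    · obtain ⟨rfl, rfl⟩ := h
      exact absurd hp hq.not_gt
  · intro e _ he
    apply hf
    induction e using Sym2.ind with
    | _ i j =>
      rw [Sym2.mk_isDiag_iff]
      by_contra hij
      apply he
      rcases lt_or_gt_of_ne hij with h | h
      · exact ⟨(i, j), by simpa using h, rfl⟩
      · exact ⟨(j, i), by simpa using h, Sym2.eq_swap⟩

namespace Multigraph

variable {m : ℕ} {d : Fin m → ℕ}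

/-- The strictly upper triangular matrix of the multiplicities of the edges. -/
def toMatrix (G : Multigraph m) (i j : Fin m) : ℕ :=
  if i < j then G.mult s(i, j) else 0

theorem toMatrix_pos {G : Multigraph m} {i j : Fin m} (h : 0 < G.toMatrix i j) :
    i < j ∧ 0 < G.mult s(i, j) := by
  unfold toMatrix at h
  split_ifs at h with hij
  · exact ⟨hij, h⟩
  · omega

theorem degree_eq_sum (G : Multigraph m) (k : Fin m) :
    G.degree k = ∑ j, G.toMatrix k j + ∑ j, G.toMatrix j k := by
  have h1 : G.degree k = ∑ e : Sym2 (Fin m), if k ∈ e then G.mult e else 0 := by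
    rw [degree, Finset.card_filter, Fintype.sum_sigma]
    refine Finset.sum_congr rfl fun e _ => ?_
    by_cases h : k ∈ e <;> simp [h]
  rw [h1, sum_sym2_eq _ fun e he => by simp [G.loopless e he]]
  have h2 : ∀ i j, (if i < j then (if k ∈ s(i, j) then G.mult s(i, j) else 0) else 0) =
      (if k = i then G.toMatrix i j else 0) + if k = j then G.toMatrix i j else 0 := by
    intro i j
    unfold toMatrix
    by_cases hij : i < j
    · by_cases hi : k = i
      · subst hi
        simp [hij, hij.ne]
      · simp [hij, hi]
    · simp [hij]
  simp only [h2, Finset.sum_add_distrib]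
  simp

theorem isArcSystem_toMatrix {G : Multigraph m} (hG : G.IsNoncrossing)
    (hd : ∀ i, G.degree i = d i) : IsArcSystem d G.toMatrix where
  lt_of_pos h := (toMatrix_pos h).1
  noncrossing h1 h2 h3 hij hkl := hG _ _ _ _ h1 h2 h3 (toMatrix_pos hij).2 (toMatrix_pos hkl).2
  degree i := by rw [← hd, degree_eq_sum]

theorem toMatrix_injective : Function.Injective (toMatrix (m := m)) := by
  intro G G' h
  have : G.mult = G'.mult := by
    funext e
    induction e using Sym2.ind with
    | _ i j =>
      rcases lt_trichotomy i j with hij | hij | hij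
      · have := congrFun (congrFun h i) j
        simpa [toMatrix, hij] using this
      · rw [G.loopless _ (by simpa using hij), G'.loopless _ (by simpa using hij)]
      · have := congrFun (congrFun h j) i
        rw [Sym2.eq_swap]
        simpa [toMatrix, hij] using this
  cases G
  cases G'
  simpa using this

/-- The multigraph with the arcs of a strictly upper triangular matrix as edges. -/
def ofMatrix (M : Fin m → Fin m → ℕ) (hM : ∀ i j, 0 < M i j → i < j) : Multigraph m where
  mult := Sym2.lift ⟨fun i j => M i j + M j i, fun _ _ => add_comm _ _⟩
  loopless e he := by
    induction e using Sym2.ind with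
    | _ i j =>
      obtain rfl : i = j := by simpa using he
      have : M i i = 0 := by
        by_contra h
        exact (hM i i (Nat.pos_of_ne_zero h)).false
      simp [this]

theorem toMatrix_ofMatrix (M : Fin m → Fin m → ℕ) (hM : ∀ i j, 0 < M i j → i < j) :
    (ofMatrix M hM).toMatrix = M := by
  funext i j
  have h0 : ∀ {i j}, ¬ i < j → M i j = 0 := fun {i j} h => by
    by_contra h'
    exact h (hM i j (Nat.pos_of_ne_zero h'))
  by_cases hij : i < j
  · simp [toMatrix, ofMatrix, hij, h0 hij.not_gt]
  · simp [toMatrix, hij, h0 hij]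

end Multigraph

variable {m : ℕ} {d : Fin m → ℕ}

/-- The `0`-outerplanar graphs of degrees `d` are the noncrossing arc systems of degrees `d`. -/
noncomputable def outerplanarEquiv (d : Fin m → ℕ) :
    OuterplanarGraph d ≃ {M : Fin m → Fin m → ℕ // IsArcSystem d M} :=
  Equiv.ofBijective (fun G => ⟨G.1.toMatrix,
    Multigraph.isArcSystem_toMatrix G.2.1.isNoncrossing G.2.2⟩) <| by
    constructor
    · intro G G' h
      exact Subtype.ext (Multigraph.toMatrix_injective (congrArg Subtype.val h))
    · rintro ⟨M, hM⟩
      have hmat := Multigraph.toMatrix_ofMatrix M fun i j => hM.lt_of_pos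
      have hpos : ∀ {i j}, i < j →
          0 < (Multigraph.ofMatrix M fun i j => hM.lt_of_pos).mult s(i, j) → 0 < M i j := by
        intro i j hij h
        rw [← hmat, Multigraph.toMatrix, if_pos hij]
        exact h
      refine ⟨⟨Multigraph.ofMatrix M fun i j => hM.lt_of_pos, ?_, fun i => ?_⟩,
        Subtype.ext hmat⟩
      · refine Multigraph.IsNoncrossing.isZeroOuterplanar fun i k j l h1 h2 h3 hij hkl => ?_
        exact hM.noncrossing h1 h2 h3 (hpos (h1.trans h2) hij) (hpos (h2.trans h3) hkl)
      · rw [Multigraph.degree_eq_sum, hmat, hM.degree]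

/-! ### The tensors as bracket monomials -/

section

variable {F : Type*} [Field F]

variable (F) in
/-- The signed monomial `± x_k y_l` of an arrow `(k, l)`. -/
noncomputable def arrowTerm (p : Fin m × Fin m) : MvPolynomial (Fin m × Fin 2) F :=
  (if p.2 < p.1 then -1 else 1) * (X (p.1, 0) * X (p.2, 1))

theorem toPoly_bTensor {G : Multigraph m} (hG : ∀ i, G.degree i = d i) (g : G.Orientation) :
    toPoly F d ((-1 : F) ^ Multigraph.Orientation.inv g • bTensor F hG g) =
      ∏ e, arrowTerm F (g e).1 := by
  rw [LinearMap.map_smul, bTensor, toPoly_tprod]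
  simp only [vertexMonomial, map_mul, map_pow, rename_X, arrowTerm, Finset.prod_mul_distrib]
  rw [smul_eq_C_mul, map_pow, map_neg, map_one]
  congr 1
  · rw [Multigraph.Orientation.inv, Finset.prod_ite, Finset.prod_const, Finset.prod_const_one,
      mul_one]
  · congr 1
    · rw [← Finset.prod_fiberwise' Finset.univ (fun e => (g e).1.1)
        fun i => (X (i, 0) : MvPolynomial (Fin m × Fin 2) F)]
      simp only [Finset.prod_const]
      rfl
    · rw [← Finset.prod_fiberwise' Finset.univ (fun e => (g e).1.2)
        fun i => (X (i, 1) : MvPolynomial (Fin m × Fin 2) F)]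
      simp only [Finset.prod_const]
      rfl

theorem sum_arrowTerm {i j : Fin m} (hij : i < j) :
    ∑ p : {p : Fin m × Fin m // s(p.1, p.2) = s(i, j)}, arrowTerm F p.1 = bracket F i j := by
  rw [← Finset.sum_subtype {(i, j), (j, i)} (fun p => by
    rw [Sym2.eq_iff]
    simp [Prod.ext_iff]) (arrowTerm F), Finset.sum_pair (by simp [hij.ne])]
  simp only [arrowTerm, hij, hij.not_gt, if_true, if_false, bracket]
  ring

/-- Choosing the directions of the edges independently expands the product of the brackets. -/
theorem toPoly_tTensor {G : Multigraph m} (hG : ∀ i, G.degree i = d i) :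
    toPoly F d (tTensor F hG) = bracketProd F G.toMatrix := by
  rw [tTensor, map_sum]
  simp only [toPoly_bTensor]
  have h1 := Finset.prod_univ_sum (ι := G.Edge)
    (κ := fun e => {p : Fin m × Fin m // s(p.1, p.2) = e.1}) (fun _ => Finset.univ)
    fun _ p => arrowTerm F p.1
  rw [Fintype.piFinset_univ] at h1
  rw [← h1, Fintype.prod_sigma]
  have h2 : ∀ e : Sym2 (Fin m), ∏ k : Fin (G.mult e),
      ∑ p : {p : Fin m × Fin m // s(p.1, p.2) = (⟨e, k⟩ : G.Edge).1}, arrowTerm F p.1 =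
      (∑ p : {p : Fin m × Fin m // s(p.1, p.2) = e}, arrowTerm F p.1) ^ G.mult e :=
    fun e => Fin.prod_const (G.mult e)
      (∑ p : {p : Fin m × Fin m // s(p.1, p.2) = e}, arrowTerm F p.1)
  rw [Finset.prod_congr rfl fun e _ => h2 e,
    prod_sym2_eq _ fun e he => by rw [G.loopless e he, pow_zero], bracketProd]
  refine Finset.prod_congr rfl fun i _ => Finset.prod_congr rfl fun j _ => ?_
  by_cases hij : i < j
  · rw [if_pos hij, sum_arrowTerm hij, Multigraph.toMatrix, if_pos hij]
  · rw [if_neg hij, Multigraph.toMatrix, if_neg hij, pow_zero]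

end

end SLTwoInvariants

theorem mainTheorem2 {F : Type*} [Field F] [CharZero F] {m : ℕ} (d : Fin m → ℕ) :
    ∃ B : Module.Basis (SLTwoInvariants.OuterplanarGraph d) F
        (SLTwoInvariants.invariantTensors F d),
      ∀ G : SLTwoInvariants.OuterplanarGraph d,
        (B G : ⨂[F] i, SLTwoInvariants.SymPow F (d i)) =
          SLTwoInvariants.tTensor F G.2.2 := by
  open SLTwoInvariants in
  obtain ⟨hli, hspan⟩ := bracketBasis (F := F) d
  let t : OuterplanarGraph d → ⨂[F] i, SymPow F (d i) := fun G => tTensor F G.2.2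
  have ht : ⇑(toPoly F d) ∘ t = arcMonomial F d ∘ outerplanarEquiv d :=
    funext fun G => toPoly_tTensor G.2.2
  have hmem : ∀ G, t G ∈ invariantTensors F d := fun G => by
    rw [mem_invariantTensors_iff_isSLInvariant, toPoly_tTensor]
    exact isSLInvariant_bracketProd _
  have htli : LinearIndependent F t := by
    refine LinearIndependent.of_comp (toPoly F d) ?_
    rw [ht]
    exact hli.comp _ (outerplanarEquiv d).injective
  have htspan : invariantTensors F d ≤ Submodule.span F (Set.range t) := by
    intro u hu
    have h1 := hspan _ (isMultihomogeneous_toPoly u)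
      ((mem_invariantTensors_iff_isSLInvariant u).1 hu)
    rw [arcSpan, ← (outerplanarEquiv d).surjective.range_comp, ← ht, Set.range_comp,
      Submodule.span_image] at h1
    obtain ⟨u', hu', h2⟩ := h1
    rwa [← toPoly_injective h2]
  let b : OuterplanarGraph d → invariantTensors F d := fun G => ⟨t G, hmem G⟩
  have hb : LinearIndependent F b :=
    LinearIndependent.of_comp (invariantTensors F d).subtype htli
  refine ⟨Module.Basis.mk hb ?_, fun G => ?_⟩
  · rw [← Submodule.map_le_map_iff_of_injective (invariantTensors F d).injective_subtype,
      Submodule.map_span, ← Set.range_comp, Submodule.map_top, Submodule.range_subtype]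
    exact htspan
  · rw [Module.Basis.mk_apply]
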